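/- Let $L\ge 1$ and consider a periodic chain with sites $i\in\mathbb Z/L\mathbb Z$, each carrying one spinless fermionic mode and one bosonic (phonon) mode. Let $\hat c_i,\hat c_i^\dagger$ and $\hat b_i,\hat b_i^\dagger$ be the usual fermion and boson annihilation and creation operators, acting on the space of finite linear combinations of the occupation-number states of the Fock space: $\{\hat c_i^\dagger,\hat c_j\}=\delta_{ij}$, $\{\hat c_i,\hat c_j\}=\{\hat c_i^\dagger,\hat c_j^\dagger\}=0$, $[\hat b_i,\hat b_j^\dagger]=\delta_{ij}$, $[\hat b_i,\hat b_j]=[\hat b_i^\dagger,\hat b_j^\dagger]=0$, and fermion operators commute with boson operators. Put $\hat n_i=\hat c_i^\dagger\hat c_i$. For $t,g,\omega,\mu\in\mathbb R$ the Hamiltonian of the one-dimensional Holstein model with a fermionic chemical potential is $$\hat H=t\sum_{i=1}^L\bigl(\hat c_i^\dagger\hat c_{i+1}+\hat c_{i+1}^\dagger\hat c_i\bigr)+g\sum_{i=1}^L\hat n_i\bigl(\hat b_i^\dagger+\hat b_i\bigr)+\omega\sum_{i=1}^L\hat b_i^\dagger\hat b_i+\mu\sum_{i=1}^L\hat n_i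 .$$ An operator is called a $k$-support operator if it is a complex polynomial in the operators $\hat c_j,\hat c_j^\dagger,\hat b_j,\hat b_j^\dagger$ with $j$ in a block $\{i,i+1,\dots,i+k-1\}$ of $k$ contiguous sites (taken modulo $L$). A $k$-local quantity is an operator that can be written as a sum of $k$-support operators but not as a sum of $(k-1)$-support operators. A $k$-local conserved quantity is a $k$-local quantity that commutes with $\hat H$. **Theorem.** If $t\ne0$, $g\ne0$ and $\omega\ne0$ (with $\mu\in\mathbb R$ arbitrary), then the model has no $k$-local conserved quantity with $3\le k\le L/2$. -/

import Mathlib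

noncomputable section

namespace Holstein

/-- Occupation-number configurations of the chain with `L` sites: the set of sites occupied by a
(spinless) fermion, and the number of phonons on every site. -/
abbrev Config (L : ℕ) : Type := Finset (Fin L) × (Fin L → ℕ)

/-- The space of finite linear combinations of occupation-number states `|S, m⟩`; this is the usual
dense invariant domain of the creation and annihilation operators in the fermion-phonon Fock
space. The state `|S, m⟩` is `Finsupp.single (S, m) 1`. -/
abbrev Fock (L : ℕ) : Type := Config L →₀ ℂ

/-- Linear operators on the span of the occupation-number states. -/
abbrev Op (L : ℕ) : Type := Module.End ℂ (Fock L)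

/-- The fermionic sign `(-1) ^ #{j ∈ S | j < i}`. -/
def fermiSign {L : ℕ} (S : Finset (Fin L)) (i : Fin L) : ℂ :=
  (-1) ^ (S.filter (fun j => j < i)).card

/-- The fermion annihilation operator `c_i`. -/
def c {L : ℕ} (i : Fin L) : Op L :=
  Finsupp.linearCombination ℂ (fun s : Config L =>
    if i ∈ s.1 then Finsupp.single ((s.1.erase i, s.2) : Config L) (fermiSign s.1 i) else 0)

/-- The fermion creation operator `c†_i`. -/
def cDag {L : ℕ} (i : Fin L) : Op L :=
  Finsupp.linearCombination ℂ (fun s : Config L =>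
    if i ∈ s.1 then 0 else Finsupp.single ((insert i s.1, s.2) : Config L) (fermiSign s.1 i))

/-- The phonon annihilation operator `b_i`, `b_i |S, m⟩ = √(m_i) |S, m - e_i⟩`
(which is `0` if `m_i = 0`). -/
def b {L : ℕ} (i : Fin L) : Op L :=
  Finsupp.linearCombination ℂ (fun s : Config L =>
    Finsupp.single ((s.1, Function.update s.2 i (s.2 i - 1)) : Config L)
      ((Real.sqrt (s.2 i : ℝ) : ℝ) : ℂ))

/-- The phonon creation operator `b†_i`, `b†_i |S, m⟩ = √(m_i + 1) |S, m + e_i⟩`. -/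
def bDag {L : ℕ} (i : Fin L) : Op L :=
  Finsupp.linearCombination ℂ (fun s : Config L =>
    Finsupp.single ((s.1, Function.update s.2 i (s.2 i + 1)) : Config L)
      ((Real.sqrt ((s.2 i : ℝ) + 1) : ℝ) : ℂ))

/-- The fermion number operator `n_i = c†_i c_i`. -/
def num {L : ℕ} (i : Fin L) : Op L := cDag i * c i

/-- The hopping term; addition of sites in `Fin L` is modulo `L` (periodic boundary conditions). -/
def hop (L : ℕ) [NeZero L] (t : ℝ) : Op L :=
  (t : ℂ) • ∑ i : Fin L, (cDag i * c (i + Fin.ofNat L 1) + cDag (i + Fin.ofNat L 1) * c i)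

/-- The electron-phonon interaction. -/
def interaction (L : ℕ) (g : ℝ) : Op L :=
  (g : ℂ) • ∑ i : Fin L, num i * (bDag i + b i)

/-- The phonon energy. -/
def phonon (L : ℕ) (ω : ℝ) : Op L :=
  (ω : ℂ) • ∑ i : Fin L, bDag i * b i

/-- The fermionic chemical-potential term. -/
def chem (L : ℕ) (μ : ℝ) : Op L :=
  (μ : ℂ) • ∑ i : Fin L, num i

/-- The Hamiltonian of the Holstein model with a fermionic chemical potential. -/
def hamiltonian (L : ℕ) [NeZero L] (t g ω μ : ℝ) : Op L :=
  hop L t + interaction L g + phonon L ω + chem L μ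

/-- The algebra of all (noncommutative) polynomials in the creation and annihilation operators of
the sites in `I`. -/
def localAlgebra {L : ℕ} (I : Set (Fin L)) : Subalgebra ℂ (Op L) :=
  Algebra.adjoin ℂ {A : Op L | ∃ j ∈ I, A = c j ∨ A = cDag j ∨ A = b j ∨ A = bDag j}

/-- The contiguous block of the `k` sites `i, i + 1, …, i + k - 1` (modulo `L`). -/
def block {L : ℕ} [NeZero L] (i : Fin L) (k : ℕ) : Set (Fin L) :=
  {s : Fin L | ∃ j < k, s = i + Fin.ofNat L j}

/-- `k`-support operators: operators supported in some contiguous block of `k` sites. -/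
def IsSupport {L : ℕ} [NeZero L] (k : ℕ) (A : Op L) : Prop :=
  ∃ i : Fin L, A ∈ localAlgebra (block i k)

/-- The space of all sums of `k`-support operators. -/
def supportSpan (L : ℕ) [NeZero L] (k : ℕ) : Submodule ℂ (Op L) :=
  Submodule.span ℂ {A : Op L | IsSupport k A}

/-- A `k`-local quantity is a sum of `k`-support operators that is not a sum of
`(k - 1)`-support operators. -/
def IsLocalQuantity {L : ℕ} [NeZero L] (k : ℕ) (Q : Op L) : Prop :=
  Q ∈ supportSpan L k ∧ Q ∉ supportSpan L (k - 1)

/-- A `k`-local conserved quantity of `H` is a `k`-local quantity that commutes with `H`. -/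
def IsLocalConservedQuantity {L : ℕ} [NeZero L] (H : Op L) (k : ℕ) (Q : Op L) : Prop :=
  IsLocalQuantity k Q ∧ Q * H - H * Q = 0

end Holstein

end

/-! Cut an operator into blocks between fermion configurations. For a polynomial in the creation and
annihilation operators each block is a phonon operator with a unique normal-ordered symbol `F S S'`,
a polynomial in variables standing for b†_j and b_j. Commuting with H becomes the polynomial
identity `symComm = 0`. There the coupling g multiplies by the linear form `field S' - field S`
(degree +1) or differentiates (degree −1), ω contributes the U(1) charge operator, and t mixes
blocks without changing the degree.

Let D ≠ 0 bound all degrees. Comparing the identity in degrees D+1 and D shows that the degree-D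
part is diagonal, has charge zero, and is unchanged when a fermion hops to a neighbouring site: the
linear form has parts of charge +1 and −1, so a nonzero multiple of it cannot have charge zero
(`eq_zero_of_chargeComp`). Hence this part depends only on the number of fermions.

Locality enters through one fact: a block of k ≤ L/2 sites misses i or i + L/2 (`FarConstraints`).
It makes the degree-D part a single polynomial p, the same for all configurations. Degree D−1 then
yields equations between neighbours, ∂p/∂b_i − ∂p/∂b_{i+1} = (b†_i − b†_{i+1}) q and their
conjugates (`exists_gradient`). Mixed second derivatives of p vanish at distance L/2, the neighbour
equations spread this to all pairs of sites, and p must be a multiple s of the phonon number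
(`eq_numberSymbol_add_const`).

So p = 0 unless D = 2. After subtracting (s/ω)H nothing of positive degree survives; the remaining
constants depend on the fermion number only, and affinely, again by locality. Thus Q is a
combination of 1, the fermion number and H, a sum of 2-support operators, which is impossible for a
k-local quantity with k ≥ 3. -/

namespace Holstein

open MvPolynomial
open scoped symmDiff

/-! ### Weighted components of polynomials. -/

section Weights

variable {σ : Type*} (w : σ → ℤ)

lemma whc_X_mul (n : ℤ) (v : σ) (p : MvPolynomial σ ℂ) :
    weightedHomogeneousComponent w n (X v * p) =
      X v * weightedHomogeneousComponent w (n - w v) p := by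
  classical
  ext e
  rw [coeff_weightedHomogeneousComponent, coeff_X_mul', coeff_X_mul',
    coeff_weightedHomogeneousComponent]
  by_cases hv : v ∈ e.support
  · have h : Finsupp.weight w (e - Finsupp.single v 1) = Finsupp.weight w e - w v := by
      rw [eq_sub_iff_add_eq]
      exact Finsupp.weight_sub_single_add (by simpa using hv)
    simp only [hv, if_true, h, sub_left_inj]
  · simp [hv]

lemma whc_pderiv (n : ℤ) (v : σ) (p : MvPolynomial σ ℂ) :
    weightedHomogeneousComponent w n (pderiv v p) =
      pderiv v (weightedHomogeneousComponent w (n + w v) p) := by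
  classical
  ext e
  rw [coeff_weightedHomogeneousComponent, coeff_pderiv, coeff_pderiv,
    coeff_weightedHomogeneousComponent]
  have h : Finsupp.weight w (e + Finsupp.single v 1) = Finsupp.weight w e + w v := by
    simp [map_add, Finsupp.weight_single]
  simp only [h, add_left_inj]
  split_ifs <;> simp

lemma whc_bounded (p : MvPolynomial σ ℂ) :
    ∃ N : ℕ, ∀ n : ℤ, N < |n| → weightedHomogeneousComponent w n p = 0 := by
  classical
  refine ⟨∑ e ∈ p.support, (Finsupp.weight w e).natAbs, fun n hn => ?_⟩
  ext e
  rw [coeff_weightedHomogeneousComponent, coeff_zero]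
  split_ifs with h
  · by_contra hc
    have : (Finsupp.weight w e).natAbs ≤ ∑ e ∈ p.support, (Finsupp.weight w e).natAbs :=
      Finset.single_le_sum (f := fun e => (Finsupp.weight w e).natAbs) (fun _ _ => Nat.zero_le _)
        (mem_support_iff.2 hc)
    rw [h] at this
    rw [Int.abs_eq_natAbs] at hn
    exact absurd (by exact_mod_cast hn) (not_lt.2 this)
  · rfl

lemma eq_zero_of_whc {p : MvPolynomial σ ℂ}
    (h : ∀ n, weightedHomogeneousComponent w n p = 0) : p = 0 := by
  classical
  ext e
  have := congrArg (coeff e) (h (Finsupp.weight w e))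
  simpa [coeff_weightedHomogeneousComponent] using this

lemma whc_neg (n : ℤ) (p : MvPolynomial σ ℂ) :
    weightedHomogeneousComponent (-w) n p = weightedHomogeneousComponent w (-n) p := by
  classical
  ext e
  have h : Finsupp.weight (-w) e = - Finsupp.weight w e := by
    simp [Finsupp.weight_apply, Finsupp.sum]
  rw [coeff_weightedHomogeneousComponent, coeff_weightedHomogeneousComponent]
  simp only [h, neg_eq_iff_eq_neg]

lemma whc_whc (n : ℤ) (p : MvPolynomial σ ℂ) (m : ℤ) :
    weightedHomogeneousComponent w m (weightedHomogeneousComponent w n p) =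
      if m = n then weightedHomogeneousComponent w n p else 0 := by
  classical
  ext e
  rw [coeff_weightedHomogeneousComponent, coeff_weightedHomogeneousComponent]
  split_ifs with h1 h2 h3 <;> simp_all [coeff_weightedHomogeneousComponent]

/-- If `(X a - X b + (X c - X d)) * q` has no component of weight above `m`, where `a`, `b` have
weight `1` and `c`, `d` weight `-1`, then `q` has no component of weight above `m - 1`. -/
lemma whc_eq_zero_of_linear_mul {a b c d : σ} (hab : a ≠ b) (ha : w a = 1) (hb : w b = 1)
    (hc : w c = -1) (hd : w d = -1) {q : MvPolynomial σ ℂ} {m : ℤ}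
    (h : ∀ n, m < n →
      weightedHomogeneousComponent w n ((X a - X b + (X c - X d)) * q) = 0) :
    ∀ n, m - 1 < n → weightedHomogeneousComponent w n q = 0 := by
  have hX : (X a - X b : MvPolynomial σ ℂ) ≠ 0 := by
    rw [sub_ne_zero]
    exact fun h => hab (X_injective h)
  obtain ⟨N, hN⟩ := whc_bounded w q
  have key : ∀ k : ℕ, ∀ n : ℤ, m - 1 < n → N + 1 ≤ n + k →
      weightedHomogeneousComponent w n q = 0 := by
    -- Downward induction, k measuring the gap from n up to N + 1. Component n + 1 of the product
    -- involves q only in weights n and n + 2, and weight n + 2 is already settled.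
    intro k
    induction k using Nat.strong_induction_on with
    | _ k ih =>
      intro n hn hk
      by_cases hl : (N : ℤ) < n
      · exact hN n (lt_of_lt_of_le hl (le_abs_self n))
      · have h1 := h (n + 1) (by omega)
        have h2 : weightedHomogeneousComponent w (n + 2) q = 0 := by
          by_cases hk2 : 2 ≤ k
          · exact ih (k - 2) (by omega) (n + 2) (by omega) (by omega)
          · exact hN _ (lt_of_lt_of_le (by omega) (le_abs_self _))
        rw [add_mul, sub_mul, sub_mul, map_add, map_sub, map_sub, whc_X_mul, whc_X_mul, whc_X_mul,
          whc_X_mul, ha, hb, hc, hd] at h1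
        rw [show n + 1 - -1 = n + 2 by ring, h2, add_sub_cancel_right, ← sub_mul] at h1
        simpa [hX] using h1
  intro n hn
  exact key (N + 1 + n.natAbs) n hn (by omega)

end Weights

/-! ### Partial derivatives of polynomials. -/

section Derivatives

variable {σ : Type*}

lemma pderiv_comm (v w : σ) (p : MvPolynomial σ ℂ) :
    pderiv v (pderiv w p) = pderiv w (pderiv v p) := by
  classical
  by_cases h : v = w
  · rw [h]
  ext e
  simp only [coeff_pderiv]
  rw [add_right_comm]
  simp [h, Ne.symm h]
  ring

lemma coeff_X_mul_pderiv (v : σ) (p : MvPolynomial σ ℂ) (e : σ →₀ ℕ) :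
    coeff e (X v * pderiv v p) = e v * coeff e p := by
  classical
  rw [coeff_X_mul']
  split_ifs with h
  · have hle : Finsupp.single v 1 ≤ e := by
      rw [Finsupp.single_le_iff]
      exact Nat.one_le_iff_ne_zero.2 (by simpa using h)
    have h1 : ((e v - 1 : ℕ) : ℂ) + 1 = e v := by
      have : 1 ≤ e v := Nat.one_le_iff_ne_zero.2 (by simpa using h)
      exact_mod_cast Nat.sub_add_cancel this
    rw [coeff_pderiv, tsub_add_cancel_of_le hle]
    simp only [Finsupp.coe_tsub, Pi.sub_apply, Finsupp.single_eq_same]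
    rw [h1, mul_comm]
  · have : e v = 0 := by simpa using h
    simp [this]

lemma eq_C_of_pderiv_eq_zero {p : MvPolynomial σ ℂ} (h : ∀ v, pderiv v p = 0) :
    p = C (coeff 0 p) := by
  classical
  ext e
  rw [coeff_C]
  split_ifs with he
  · rw [he]
  · obtain ⟨v, hv⟩ : ∃ v, e v ≠ 0 := by
      by_contra! hc
      exact he (Finsupp.ext fun v => (hc v).symm)
    have := coeff_X_mul_pderiv v p e
    rw [h v, mul_zero, coeff_zero] at this
    rcases mul_eq_zero.1 this.symm with h' | h'
    · exact absurd (by exact_mod_cast h') hv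
    · exact h'

lemma totalDegree_X_sub_X {a b : σ} (h : a ≠ b) :
    (X a - X b : MvPolynomial σ ℂ).totalDegree = 1 := by
  classical
  apply le_antisymm
  · refine (totalDegree_sub _ _).trans ?_
    simp
  · have : coeff (Finsupp.single a 1) (X a - X b : MvPolynomial σ ℂ) ≠ 0 := by
      have : Finsupp.single b 1 ≠ Finsupp.single a 1 := by
        intro h'
        exact h ((Finsupp.single_left_injective one_ne_zero) h').symm
      simp [coeff_X, this]
    have := le_totalDegree (mem_support_iff.2 this)
    simpa using this

/-- In the coordinate u = X a − X b the operator on the right is −u∂_u, whose eigenvalues are never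
positive. Concretely S = (X a − X b) T, where T has smaller degree and satisfies the same equation
with n + 1 in place of n. -/
lemma eq_zero_of_natCast_mul_eq {a b : σ} (h : a ≠ b) (S : MvPolynomial σ ℂ) (n : ℕ)
    (hS : ((n : MvPolynomial σ ℂ) + 1) * S = (X a - X b) * pderiv b S) : S = 0 := by
  have hX : (X a - X b : MvPolynomial σ ℂ) ≠ 0 := by
    rw [sub_ne_zero]
    exact fun h' => h (X_injective h')
  induction hd : S.totalDegree using Nat.strong_induction_on generalizing S n with
  | _ d ih =>
    by_contra hne
    have hn : ((n : ℂ) + 1) ≠ 0 := by exact_mod_cast Nat.succ_ne_zero n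
    obtain ⟨T, hT⟩ : ∃ T, S = (X a - X b) * T := by
      refine ⟨C ((n : ℂ) + 1)⁻¹ * pderiv b S, ?_⟩
      rw [mul_left_comm, ← hS, ← mul_assoc]
      have : C ((n : ℂ) + 1)⁻¹ * ((n : MvPolynomial σ ℂ) + 1) = 1 := by
        rw [show ((n : MvPolynomial σ ℂ) + 1) = C ((n : ℂ) + 1) by simp, ← C_mul,
          inv_mul_cancel₀ hn, C_1]
      rw [this, one_mul]
    have hT0 : T ≠ 0 := by
      rintro rfl
      exact hne (by simpa using hT)
    have hdeg : S.totalDegree = 1 + T.totalDegree := by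
      rw [hT, totalDegree_mul_of_isDomain hX hT0, totalDegree_X_sub_X h]
    refine hT0 (ih T.totalDegree (by omega) T (n + 1) ?_ rfl)
    rw [hT, Derivation.leibniz, map_sub, pderiv_X_self, pderiv_X_of_ne h, smul_eq_mul,
      smul_eq_mul] at hS
    apply mul_left_cancel₀ hX
    push_cast
    linear_combination hS

end Derivatives

/-! ### Gradient equations for a pair of sites. -/

section Classification

variable {ι : Type*}

/-- All second derivatives mixing the variables of the sites `i` and `j` vanish. -/
def MixedZero (p : MvPolynomial (ι ⊕ ι) ℂ) (i j : ι) : Prop :=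
  ∀ v w : ι ⊕ ι, Sum.elim id id v = i → Sum.elim id id w = j → pderiv v (pderiv w p) = 0

lemma MixedZero.symm {p : MvPolynomial (ι ⊕ ι) ℂ} {i j : ι} (h : MixedZero p i j) :
    MixedZero p j i := fun v w hv hw => by
  rw [pderiv_comm]
  exact h w v hw hv

variable {p S : MvPolynomial (ι ⊕ ι) ℂ} {i i' : ι}

lemma pderiv_sub_mul {σ : Type*} {v a b : σ} (ha : a ≠ v) (hb : b ≠ v) (q : MvPolynomial σ ℂ) :
    pderiv v ((X a - X b) * q) = (X a - X b) * pderiv v q := by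
  rw [Derivation.leibniz, map_sub, pderiv_X_of_ne ha, pderiv_X_of_ne hb]
  simp

lemma pderiv_sub_mul_left {σ : Type*} {a b : σ} (hab : a ≠ b) (q : MvPolynomial σ ℂ) :
    pderiv a ((X a - X b) * q) = (X a - X b) * pderiv a q + q := by
  rw [Derivation.leibniz, map_sub, pderiv_X_self, pderiv_X_of_ne hab.symm]
  simp

lemma pderiv_sub_mul_right {σ : Type*} {a b : σ} (hab : a ≠ b) (q : MvPolynomial σ ℂ) :
    pderiv b ((X a - X b) * q) = (X a - X b) * pderiv b q - q := by
  rw [Derivation.leibniz, map_sub, pderiv_X_self, pderiv_X_of_ne hab]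
  simp
  ring

lemma X_sub_X_ne_zero {σ : Type*} {a b : σ} (hab : a ≠ b) : (X a - X b : MvPolynomial σ ℂ) ≠ 0 := by
  rw [sub_ne_zero]
  exact fun h' => hab (X_injective h')

/-- Put K = ∂_u ∂_b q. The hypothesis reads (X a − X b) K = ∂_u q; differentiating in b gives 2K =
(X a − X b) ∂_b K, so K = 0 and then ∂_u q = 0. -/
lemma pderiv_eq_zero_of_pderiv_pderiv_right {σ : Type*} {u a b : σ} (hab : a ≠ b) (ha : a ≠ u)
    (hb : b ≠ u) {q : MvPolynomial σ ℂ} (h : pderiv u (pderiv b ((X a - X b) * q)) = 0) :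
    pderiv u q = 0 := by
  rw [pderiv_sub_mul_right hab, map_sub, pderiv_sub_mul ha hb] at h
  have K : pderiv u (pderiv b q) = 0 := by
    apply eq_zero_of_natCast_mul_eq hab _ 1
    have h' := congrArg (pderiv b) h
    rw [map_zero, map_sub, pderiv_sub_mul_right hab, pderiv_comm b u q] at h'
    push_cast
    linear_combination -h'
  rw [K] at h
  linear_combination -h

lemma pderiv_eq_zero_of_pderiv_pderiv_left {σ : Type*} {u a b : σ} (hab : a ≠ b) (ha : a ≠ u)
    (hb : b ≠ u) {q : MvPolynomial σ ℂ} (h : pderiv u (pderiv a ((X a - X b) * q)) = 0) :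
    pderiv u q = 0 := by
  apply pderiv_eq_zero_of_pderiv_pderiv_right hab.symm hb ha
  rw [← neg_sub, neg_mul, map_neg, map_neg, h, neg_zero]

section

variable (hii : i ≠ i')
  (hz : pderiv (.inr i) p - pderiv (.inr i') p = (X (.inl i) - X (.inl i')) * S)
  (hy : pderiv (.inl i) p - pderiv (.inl i') p = (X (.inr i) - X (.inr i')) * S)

include hii hz hy

/-- Apply ∂_w and then `pderiv (.inl i)`: both left sides die, since they mix i with j. The `hy`
equation gives ∂_{inl i} ∂_w S = 0, after which only the Leibniz term ∂_w S is left in the `hz`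
equation. -/
lemma pderiv_eq_zero_of_mixedZero {j : ι} (hj : j ≠ i) (hj' : j ≠ i') (h : MixedZero p i j)
    {w : ι ⊕ ι} (hw : Sum.elim id id w = j) : pderiv w S = 0 := by
  have hwl : ∀ k, k ≠ j → (Sum.inl k : ι ⊕ ι) ≠ w := by
    rintro k hk rfl; exact hk hw
  have hwr : ∀ k, k ≠ j → (Sum.inr k : ι ⊕ ι) ≠ w := by
    rintro k hk rfl; exact hk hw
  have h1 := congrArg (pderiv w) hz
  rw [pderiv_sub_mul (hwl i hj.symm) (hwl i' hj'.symm), map_sub,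
    h.symm w (.inr i) hw rfl] at h1
  have h2 := congrArg (pderiv w) hy
  rw [pderiv_sub_mul (hwr i hj.symm) (hwr i' hj'.symm), map_sub,
    h.symm w (.inl i) hw rfl] at h2
  have k1 := congrArg (pderiv (.inl i)) h1
  have k2 := congrArg (pderiv (.inl i)) h2
  have e : ∀ u v : ι ⊕ ι, Sum.elim id id u = i →
      pderiv u (0 - pderiv w (pderiv v p)) = 0 := by
    intro u v hu
    rw [map_sub, map_zero, zero_sub, neg_eq_zero, pderiv_comm w v, pderiv_comm u v,
      h u w hu hw, map_zero]
  rw [e (.inl i) _ rfl, pderiv_sub_mul_left (by simpa using hii)] at k1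
  rw [e (.inl i) _ rfl, pderiv_sub_mul (by simp) (by simp)] at k2
  have k3 : pderiv (.inl i) (pderiv w S) = 0 := by
    have := k2.symm
    rw [mul_eq_zero] at this
    exact this.resolve_left (X_sub_X_ne_zero (by simpa using hii))
  rw [k3, mul_zero, zero_add] at k1
  exact k1.symm

/-- Since ∂_w S = 0, applying ∂_w to both equations shows that the gradient at i' has the same ∂_w
as the gradient at i, namely zero. -/
lemma MixedZero.step {j : ι} (hj : j ≠ i) (hj' : j ≠ i') (h : MixedZero p i j) :
    MixedZero p i' j := by
  intro v w hv hw
  have hS := pderiv_eq_zero_of_mixedZero hii hz hy hj hj' h hw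
  have hwl : ∀ k, k ≠ j → (Sum.inl k : ι ⊕ ι) ≠ w := by
    rintro k hk rfl; exact hk hw
  have hwr : ∀ k, k ≠ j → (Sum.inr k : ι ⊕ ι) ≠ w := by
    rintro k hk rfl; exact hk hw
  have h1 := congrArg (pderiv w) hz
  rw [pderiv_sub_mul (hwl i hj.symm) (hwl i' hj'.symm), map_sub,
    h.symm w (.inr i) hw rfl, hS] at h1
  have h2 := congrArg (pderiv w) hy
  rw [pderiv_sub_mul (hwr i hj.symm) (hwr i' hj'.symm), map_sub,
    h.symm w (.inl i) hw rfl, hS] at h2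
  rw [pderiv_comm]
  rcases v with v | v <;> obtain rfl : v = i' := hv
  · simpa using h2
  · simpa using h1

/-- One derivative at i and one at i' annihilate both left sides. Choosing one of them in the linear
factor and the other in a conjugate variable gives the four derivatives of S at i and i'; the other
sites fall under `pderiv_eq_zero_of_mixedZero`. -/
lemma exists_const_of_mixedZero (h : ∀ j k, j ≠ k → MixedZero p j k) :
    ∃ s : ℂ, S = C s := by
  have hl : (Sum.inl i : ι ⊕ ι) ≠ Sum.inl i' := by simpa using hii
  have hr : (Sum.inr i : ι ⊕ ι) ≠ Sum.inr i' := by simpa using hii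
  have e : ∀ u v x y : ι ⊕ ι, Sum.elim id id u = i → Sum.elim id id v = i' →
      Sum.elim id id x = i → Sum.elim id id y = i' →
      pderiv u (pderiv v (pderiv x p - pderiv y p)) = 0 := by
    intro u v x y hu hv hx hy
    rw [map_sub, map_sub, h i' i hii.symm v x hv hx, map_zero, pderiv_comm u v,
      h i i' hii u y hu hy, map_zero, sub_zero]
  have ez := fun u v hu hv => hz ▸ e u v (.inr i) (.inr i') hu hv rfl rfl
  have ey := fun u v hu hv => hy ▸ e u v (.inl i) (.inl i') hu hv rfl rfl
  clear e
  have d1 : pderiv (.inr i) S = 0 :=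
    pderiv_eq_zero_of_pderiv_pderiv_right hl (by simp) (by simp) (ez (.inr i) (.inl i') rfl rfl)
  have d2 : pderiv (.inl i) S = 0 :=
    pderiv_eq_zero_of_pderiv_pderiv_right hr (by simp) (by simp) (ey (.inl i) (.inr i') rfl rfl)
  have d3 : pderiv (.inl i') S = 0 := by
    refine pderiv_eq_zero_of_pderiv_pderiv_left hr (by simp) (by simp) ?_
    rw [pderiv_comm]
    exact ey (.inr i) (.inl i') rfl rfl
  have d4 : pderiv (.inr i') S = 0 := by
    refine pderiv_eq_zero_of_pderiv_pderiv_left hl (by simp) (by simp) ?_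
    rw [pderiv_comm]
    exact ez (.inl i) (.inr i') rfl rfl
  refine ⟨coeff 0 S, eq_C_of_pderiv_eq_zero fun v => ?_⟩
  by_cases h1 : Sum.elim id id v = i
  · rcases v with v | v
    · rw [show v = i from h1, d2]
    · rw [show v = i from h1, d1]
  by_cases h2 : Sum.elim id id v = i'
  · rcases v with v | v
    · rw [show v = i' from h2, d3]
    · rw [show v = i' from h2, d4]
  have h3 := h i (Sum.elim id id v) (Ne.symm h1)
  generalize hj : Sum.elim id id v = j at h1 h2 h3
  exact pderiv_eq_zero_of_mixedZero hii hz hy h1 h2 h3 hj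

end

/-- The symbol of the phonon number operator. -/
noncomputable def numberSymbol (ι : Type*) [Fintype ι] : MvPolynomial (ι ⊕ ι) ℂ :=
  ∑ i, X (.inl i) * X (.inr i)

variable [Fintype ι]

lemma pderiv_inl_numberSymbol (i : ι) : pderiv (.inl i) (numberSymbol ι) = X (.inr i) := by
  classical
  simp [numberSymbol, pderiv_X, Pi.single_apply]

lemma pderiv_inr_numberSymbol (i : ι) : pderiv (.inr i) (numberSymbol ι) = X (.inl i) := by
  classical
  simp [numberSymbol, pderiv_X, Pi.single_apply]

lemma coeff_single_numberSymbol (v : ι ⊕ ι) :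
    coeff (Finsupp.single v 1) (numberSymbol ι) = 0 := by
  classical
  rw [numberSymbol, coeff_sum]
  refine Finset.sum_eq_zero fun i _ => ?_
  rw [coeff_X_mul']
  split_ifs with h
  · rw [coeff_X, if_neg]
    intro h'
    have h3 : Sum.inl i = v := by simpa [Finsupp.single_apply, eq_comm] using h
    subst h3
    have := congrArg (fun f => f (Sum.inr i)) h'
    simp at this
  · rfl

end Classification

/-! ### Propagation around the periodic chain. -/

section Ring

variable {L : ℕ} [NeZero L]

lemma add_ofNat_add_ofNat (i : Fin L) (a b : ℕ) :
    i + Fin.ofNat L a + Fin.ofNat L b = i + Fin.ofNat L (a + b) := by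
  apply Fin.ext
  simp [Fin.val_add, Fin.ofNat, add_assoc]

lemma add_ofNat_self (i : Fin L) : i + Fin.ofNat L L = i := by
  apply Fin.ext
  simp [Fin.ofNat]

lemma add_ofNat_zero (i : Fin L) : i + Fin.ofNat L 0 = i := by
  apply Fin.ext
  simp

lemma add_ofNat_inj (i : Fin L) {a b : ℕ} (ha : a < L) (hb : b < L)
    (h : i + Fin.ofNat L a = i + Fin.ofNat L b) : a = b := by
  have := congrArg Fin.val (add_left_cancel h)
  simpa [Fin.ofNat, Nat.mod_eq_of_lt ha, Nat.mod_eq_of_lt hb] using this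

lemma add_ofNat_ne (i : Fin L) {m : ℕ} (h0 : 1 ≤ m) (hm : m < L) : i + Fin.ofNat L m ≠ i := by
  intro h
  have := add_ofNat_inj i hm (show 0 < L by omega) (by rw [h, add_ofNat_zero])
  omega

lemma exists_add_ofNat (i j : Fin L) : ∃ m < L, j = i + Fin.ofNat L m := by
  refine ⟨(j - i).val, (j - i).2, ?_⟩
  have : Fin.ofNat L (j - i).val = j - i := by
    apply Fin.ext
    simp [Fin.ofNat, Nat.mod_eq_of_lt (j - i).2]
  rw [this, add_sub_cancel]

variable {p : MvPolynomial (Fin L ⊕ Fin L) ℂ} {S : Fin L → MvPolynomial (Fin L ⊕ Fin L) ℂ}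
  (hL : 2 ≤ L)
  (hz : ∀ i, pderiv (.inr i) p - pderiv (.inr (i + Fin.ofNat L 1)) p =
    (X (.inl i) - X (.inl (i + Fin.ofNat L 1))) * S i)
  (hy : ∀ i, pderiv (.inl i) p - pderiv (.inl (i + Fin.ofNat L 1)) p =
    (X (.inr i) - X (.inr (i + Fin.ofNat L 1))) * S i)
  {h : ℕ} (h1 : h < L) (h2 : L ≤ 2 * h + 1)
  (hM : ∀ i, MixedZero p i (i + Fin.ofNat L h))

include hL hz hy h1 h2 hM

/-- Distance h read the other way round the ring is L − h; moving one site forward by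
`MixedZero.step` reaches all distances from L − h to L − 1. Smaller distances m satisfy m ≤ h by
`h2`, so the reversed distance L − m is in that range. -/
lemma mixedZero_of_far (j k : Fin L) (hjk : j ≠ k) : MixedZero p j k := by
  have key : ∀ n, L - h + n < L → ∀ j, MixedZero p (j + Fin.ofNat L (L - h + n)) j := by
    intro n
    induction n with
    | zero =>
      intro _ j
      have := hM (j + Fin.ofNat L (L - h))
      rwa [add_ofNat_add_ofNat, Nat.sub_add_cancel h1.le, add_ofNat_self] at this
    | succ n ih =>
      intro hn j
      have := ih (by omega) j
      rw [← add_assoc, ← add_ofNat_add_ofNat]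
      refine this.step (add_ofNat_ne _ le_rfl (by omega)).symm (hz _) (hy _)
        (add_ofNat_ne j (by omega) (by omega)).symm ?_
      rw [add_ofNat_add_ofNat]
      exact (add_ofNat_ne j (by omega) (by omega)).symm
  obtain ⟨m, hm, rfl⟩ := exists_add_ofNat k j
  have hm0 : 1 ≤ m := by
    by_contra h0
    obtain rfl : m = 0 := by omega
    exact hjk (add_ofNat_zero k)
  by_cases hmh : L - h ≤ m
  · have := key (m - (L - h)) (by omega) k
    rwa [Nat.add_sub_cancel' hmh] at this
  · have := key (L - m - (L - h)) (by omega) (k + Fin.ofNat L m)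
    rw [Nat.add_sub_cancel' (by omega), add_ofNat_add_ofNat,
      Nat.add_sub_cancel' hm.le, add_ofNat_self] at this
    exact this.symm

/-- A polynomial satisfying the nearest-neighbour constraints, without mixed second derivatives at
far apart sites and without linear terms, is affine in the phonon number. -/
theorem eq_numberSymbol_add_const (hlin : ∀ v, coeff (Finsupp.single v 1) p = 0) :
    ∃ s c : ℂ, p = C s * numberSymbol (Fin L) + C c := by
  have hM' := mixedZero_of_far hL hz hy h1 h2 hM
  have hne : ∀ i : Fin L, i ≠ i + Fin.ofNat L 1 :=
    fun i => (add_ofNat_ne i le_rfl (by omega)).symm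
  choose s hs using fun i => exists_const_of_mixedZero (hne i) (hz i) (hy i) hM'
  have hl : ∀ i : Fin L, (Sum.inl i : Fin L ⊕ Fin L) ≠ Sum.inl (i + Fin.ofNat L 1) :=
    fun i => by simpa using hne i
  have hr : ∀ i : Fin L, (Sum.inr i : Fin L ⊕ Fin L) ≠ Sum.inr (i + Fin.ofNat L 1) :=
    fun i => by simpa using hne i
  -- The same on-site second derivative is read off from the left end of a link here and from the
  -- right end in `A2`; comparing them makes s constant along the ring.
  have A1 : ∀ i, pderiv (.inl i) (pderiv (.inr i) p) = C (s i) := by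
    intro i
    have := congrArg (pderiv (.inl i)) (hz i)
    rw [hs, pderiv_sub_mul_left (hl i), map_sub,
      hM' _ _ (hne i) (.inl i) (.inr (i + Fin.ofNat L 1)) rfl rfl] at this
    simpa using this
  have A2 : ∀ i, pderiv (.inl (i + Fin.ofNat L 1)) (pderiv (.inr (i + Fin.ofNat L 1)) p) =
      C (s i) := by
    intro i
    have := congrArg (pderiv (.inl (i + Fin.ofNat L 1))) (hz i)
    rw [hs, pderiv_sub_mul_right (hl i), map_sub, hM' _ _ (hne i).symm _ _ rfl rfl] at this
    simpa using this
  have A3 : ∀ i, pderiv (.inr i) (pderiv (.inr i) p) = 0 := by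
    intro i
    have := congrArg (pderiv (.inr i)) (hz i)
    rw [hs, pderiv_sub_mul (by simp) (by simp), map_sub,
      hM' _ _ (hne i) (.inr i) (.inr (i + Fin.ofNat L 1)) rfl rfl] at this
    simpa using this
  have A4 : ∀ i, pderiv (.inl i) (pderiv (.inl i) p) = 0 := by
    intro i
    have := congrArg (pderiv (.inl i)) (hy i)
    rw [hs, pderiv_sub_mul (by simp) (by simp), map_sub,
      hM' _ _ (hne i) (.inl i) (.inl (i + Fin.ofNat L 1)) rfl rfl] at this
    simpa using this
  have hsucc : ∀ i, s (i + Fin.ofNat L 1) = s i := by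
    intro i
    exact C_injective _ _ ((A1 _).symm.trans (A2 i))
  have hconst : ∀ i, s i = s 0 := by
    intro i
    obtain ⟨m, -, rfl⟩ := exists_add_ofNat 0 i
    induction m with
    | zero => rw [add_ofNat_zero]
    | succ m ih => rw [← add_ofNat_add_ofNat, hsucc, ih]
  -- All second derivatives of q vanish, so its first derivatives are constants; these are its
  -- linear coefficients, which are zero.
  set q := p - C (s 0) * numberSymbol (Fin L) with hq
  have hq1 : ∀ v, pderiv v q = pderiv v p - C (s 0) * pderiv v (numberSymbol (Fin L)) := by
    intro v
    rw [hq, map_sub, pderiv_C_mul]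
  have hq2 : ∀ v w, pderiv v (pderiv w q) = 0 := by
    intro v w
    rw [hq1, map_sub, pderiv_C_mul]
    by_cases hvw : Sum.elim id id v = Sum.elim id id w
    · rcases v with i | i <;> rcases w with j | j <;> obtain rfl : i = j := hvw
      · simp [A4, pderiv_inl_numberSymbol]
      · rw [A1, pderiv_inr_numberSymbol, pderiv_X_self, hconst i]
        simp
      · rw [pderiv_comm, A1, pderiv_inl_numberSymbol, pderiv_X_self, hconst i]
        simp
      · simp [A3, pderiv_inr_numberSymbol]
    · rw [hM' _ _ hvw v w rfl rfl, zero_sub, neg_eq_zero]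
      have hvw' := Ne.symm hvw
      rcases v with i | i <;> rcases w with j | j <;>
        simp only [pderiv_inl_numberSymbol, pderiv_inr_numberSymbol] <;>
        rw [pderiv_X_of_ne (by simp; try exact hvw'), mul_zero]
  have hq3 : ∀ v, pderiv v q = 0 := by
    intro v
    rw [eq_C_of_pderiv_eq_zero (fun w => hq2 w v), coeff_pderiv, zero_add, hq, coeff_sub,
      coeff_C_mul, hlin, coeff_single_numberSymbol]
    simp
  refine ⟨s 0, coeff 0 q, ?_⟩
  rw [← eq_C_of_pderiv_eq_zero hq3, hq]
  ring

end Ring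

/-! ### Symbols, charge and the symbol of the commutator. -/

/-- Normal-ordered phonon symbols: `X (inl j)` stands for `b†_j` and `X (inr j)` for `b_j`. -/
abbrev Sym (L : ℕ) : Type := MvPolynomial (Fin L ⊕ Fin L) ℂ

/-- The component of total degree `n`. -/
noncomputable abbrev comp {L : ℕ} (n : ℤ) : Sym L →ₗ[ℂ] Sym L :=
  weightedHomogeneousComponent (fun _ => (1 : ℤ)) n

/-- The `U(1)` charge of the variables. -/
def chargeWeight {L : ℕ} : Fin L ⊕ Fin L → ℤ := Sum.elim (fun _ => -1) (fun _ => 1)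

/-- The component of charge `n`. -/
noncomputable abbrev chargeComp {L : ℕ} (n : ℤ) : Sym L →ₗ[ℂ] Sym L :=
  weightedHomogeneousComponent chargeWeight n

variable {L : ℕ}

/-- The symbol of `∑ j ∈ S, (b†_j + b_j)`. -/
noncomputable def field (S : Finset (Fin L)) : Sym L := ∑ j ∈ S, (X (.inl j) + X (.inr j))

/-- The symbol of the commutator with the phonon number. -/
noncomputable def charge : Sym L →ₗ[ℂ] Sym L :=
  ∑ j, (LinearMap.mulLeft ℂ (X (.inr j)) ∘ₗ (pderiv (.inr j)).toLinearMap -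
    LinearMap.mulLeft ℂ (X (.inl j)) ∘ₗ (pderiv (.inl j)).toLinearMap)

lemma charge_apply (p : Sym L) :
    charge p = ∑ j, (X (.inr j) * pderiv (.inr j) p - X (.inl j) * pderiv (.inl j) p) := by
  simp [charge]

/-- The symbol of `Q * H - H * Q`, where `F` is the symbol of `Q` and `T` is the hopping matrix. -/
noncomputable def symComm (g ω μ : ℂ) (T : Finset (Fin L) → Finset (Fin L) → ℂ)
    (F : Finset (Fin L) → Finset (Fin L) → Sym L) (S S' : Finset (Fin L)) : Sym L :=
  C g * ((field S' - field S) * F S S') +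
  C g * (∑ j ∈ S', pderiv (.inr j) (F S S') - ∑ j ∈ S, pderiv (.inl j) (F S S')) +
  C ω * charge (F S S') + C (μ * ((S'.card : ℂ) - S.card)) * F S S' +
  ∑ R, (C (T R S') * F S R - C (T S R) * F R S')

lemma comp_field_mul (n : ℤ) (S : Finset (Fin L)) (p : Sym L) :
    comp n (field S * p) = field S * comp (n - 1) p := by
  simp only [field, Finset.sum_mul, map_sum, add_mul, map_add, whc_X_mul]

lemma comp_charge (n : ℤ) (p : Sym L) : comp n (charge p) = charge (comp n p) := by
  simp only [charge_apply, map_sum, map_sub, whc_X_mul, whc_pderiv, sub_add_cancel]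

lemma comp_pderiv (n : ℤ) (v : Fin L ⊕ Fin L) (p : Sym L) :
    comp n (pderiv v p) = pderiv v (comp (n + 1) p) := whc_pderiv _ _ _ _

lemma coeff_charge (p : Sym L) (e : Fin L ⊕ Fin L →₀ ℕ) :
    coeff e (charge p) = (Finsupp.weight (chargeWeight (L := L)) e : ℤ) * coeff e p := by
  rw [charge_apply, coeff_sum]
  simp only [coeff_sub, coeff_X_mul_pderiv, ← sub_mul, ← Finset.sum_mul]
  congr 1
  rw [Finsupp.weight_eq_sum, Fintype.sum_sum_type]
  simp [chargeWeight]
  ring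

lemma chargeComp_charge (n : ℤ) (p : Sym L) :
    chargeComp n (charge p) = C (n : ℂ) * chargeComp n p := by
  classical
  ext e
  rw [coeff_C_mul, coeff_weightedHomogeneousComponent, coeff_weightedHomogeneousComponent,
    coeff_charge]
  split_ifs with h
  · rw [h]
  · simp

lemma chargeComp_eq_zero {p : Sym L} (h : charge p = 0) {n : ℤ} (hn : n ≠ 0) :
    chargeComp n p = 0 := by
  have := chargeComp_charge n p
  rw [h, map_zero] at this
  simpa [hn] using this.symm

lemma chargeComp_zero_eq {p : Sym L} (h : charge p = 0) : chargeComp 0 p = p := by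
  rw [← sub_eq_zero]
  apply eq_zero_of_whc chargeWeight
  intro n
  rw [map_sub, whc_whc]
  split_ifs with hn
  · rw [hn, sub_self]
  · rw [chargeComp_eq_zero h hn, sub_self]

/-- A linear monomial has charge 1 or −1, never 0. -/
lemma coeff_single_eq_zero {p : Sym L} (h : charge p = 0) (v : Fin L ⊕ Fin L) :
    coeff (Finsupp.single v 1) p = 0 := by
  have := congrArg (coeff (Finsupp.single v 1)) h
  rw [coeff_charge, coeff_zero, Finsupp.weight_single] at this
  rcases v with v | v <;> simpa [chargeWeight] using this

lemma field_ne {S S' : Finset (Fin L)} (h : S ≠ S') : field S' - field S ≠ 0 := by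
  classical
  intro h'
  apply h
  have hc : ∀ (S : Finset (Fin L)) (i : Fin L),
      coeff (Finsupp.single (.inl i) 1) (field S) = if i ∈ S then 1 else 0 := by
    intro S i
    simp [field, coeff_sum, coeff_X, Finsupp.single_left_inj]
  ext i
  have := congrArg (coeff (Finsupp.single (.inl i) 1)) h'
  rw [coeff_sub, hc, hc, coeff_zero, sub_eq_zero] at this
  by_cases h1 : i ∈ S <;> by_cases h2 : i ∈ S' <;> simp_all

lemma field_insert_sub {R : Finset (Fin L)} {i j : Fin L} (hi : i ∉ R) (hj : j ∉ R) :
    field (insert j R) - field (insert i R) =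
      -(X (.inr i) - X (.inr j) + (X (.inl i) - X (.inl j))) := by
  simp only [field, Finset.sum_insert hi, Finset.sum_insert hj]
  ring

lemma eq_zero_of_pderiv_eq_zero {p : Sym L} {n : ℤ} (hn : n ≠ 0) (hp : comp n p = p)
    (h : ∀ v, pderiv v p = 0) : p = 0 := by
  classical
  rw [← hp]
  rw [eq_C_of_pderiv_eq_zero h]
  ext e
  rw [coeff_weightedHomogeneousComponent, coeff_C]
  split_ifs with h1 h2
  · subst h2
    simp at h1
    exact absurd h1.symm hn
  · rfl
  · rfl

lemma comp_numberSymbol (n : ℤ) :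
    comp n (numberSymbol (Fin L)) = if n = 2 then numberSymbol (Fin L) else 0 := by
  classical
  have hX : ∀ (m : ℤ) (v : Fin L ⊕ Fin L), comp m (X v : Sym L) = if m = 1 then X v else 0 := by
    intro m v
    ext e
    rw [coeff_weightedHomogeneousComponent, coeff_X]
    by_cases he : Finsupp.single v 1 = e
    · subst he
      simp [Finsupp.weight_single, eq_comm]
      split_ifs <;> simp
    · simp only [he, if_false, ite_self]
      split_ifs <;> simp [coeff_X, he]
  simp only [numberSymbol, map_sum, whc_X_mul, hX]
  by_cases hn : n = 2
  · simp [hn]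
  · simp [hn, show n - 1 ≠ 1 by omega]

lemma comp_C (n : ℤ) (c : ℂ) : comp n (C c : Sym L) = if n = 0 then C c else 0 := by
  classical
  ext e
  rw [coeff_weightedHomogeneousComponent, coeff_C]
  by_cases he : 0 = e
  · subst he
    simp [eq_comm]
    split_ifs <;> simp
  · simp only [he, if_false, ite_self]
    split_ifs <;> simp [coeff_C, he]

lemma comp_symComm (g ω μ : ℂ) (T : Finset (Fin L) → Finset (Fin L) → ℂ)
    (F : Finset (Fin L) → Finset (Fin L) → Sym L) (S S' : Finset (Fin L)) (n : ℤ) :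
    comp n (symComm g ω μ T F S S') =
      C g * ((field S' - field S) * comp (n - 1) (F S S')) +
      C g * (∑ j ∈ S', pderiv (.inr j) (comp (n + 1) (F S S')) -
        ∑ j ∈ S, pderiv (.inl j) (comp (n + 1) (F S S'))) +
      C ω * charge (comp n (F S S')) +
      C (μ * ((S'.card : ℂ) - S.card)) * comp n (F S S') +
      ∑ R, (C (T R S') * comp n (F S R) - C (T S R) * comp n (F R S')) := by
  simp only [symComm, map_add, map_sum, map_sub, weightedHomogeneousComponent_C_mul,
    sub_mul, comp_field_mul, comp_pderiv, comp_charge]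

/-- The consequences, for the symbol of an operator, of being built from blocks too short to contain
both a site and the one `h` steps away. -/
structure FarConstraints [NeZero L] (h : ℕ) (F : Finset (Fin L) → Finset (Fin L) → Sym L) :
    Prop where
  mixed : ∀ S S' i, MixedZero (F S S') i (i + Fin.ofNat L h)
  flip : ∀ S i v, Sum.elim id id v = i →
    pderiv v (F (S ∆ {i + Fin.ofNat L h}) (S ∆ {i + Fin.ofNat L h}) - F S S) = 0
  flip_flip : ∀ S i, F (S ∆ {i} ∆ {i + Fin.ofNat L h}) (S ∆ {i} ∆ {i + Fin.ofNat L h}) -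
    F (S ∆ {i}) (S ∆ {i}) - F (S ∆ {i + Fin.ofNat L h}) (S ∆ {i + Fin.ofNat L h}) + F S S = 0

/-- The constraints on the symbol of a conserved quantity built from short blocks. -/
structure Constraints [NeZero L] (g ω μ : ℂ) (T : Finset (Fin L) → Finset (Fin L) → ℂ) (h : ℕ)
    (F : Finset (Fin L) → Finset (Fin L) → Sym L) : Prop extends FarConstraints h F where
  comm : ∀ S S', symComm g ω μ T F S S' = 0

/-! ### Functions of configurations invariant under nearest-neighbour moves. -/

section Swaps

/-- If the site i + m on the way is occupied, its particle first moves on to i + m + 1, and the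
particle from i then takes the vacated place; the particles being identical, the resulting set is
the desired one. -/
lemma eq_of_insert_shift [NeZero L] {α : Type*} {f : Finset (Fin L) → α}
    (hf : ∀ (R : Finset (Fin L)) i, i ∉ R → i + Fin.ofNat L 1 ∉ R →
      f (insert i R) = f (insert (i + Fin.ofNat L 1) R)) (i : Fin L) (m : ℕ) (hm : m < L)
    (R : Finset (Fin L)) (hi : i ∉ R) (hj : i + Fin.ofNat L m ∉ R) :
    f (insert i R) = f (insert (i + Fin.ofNat L m) R) := by
  induction m generalizing R with
  | zero => rw [add_ofNat_zero]
  | succ m ih =>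
    rw [← add_ofNat_add_ofNat] at hj ⊢
    by_cases hR : i + Fin.ofNat L m ∈ R
    · rcases Nat.eq_zero_or_pos m with rfl | hpos
      · rw [add_ofNat_zero] at hR
        exact absurd hR hi
      have hne : i + Fin.ofNat L m ≠ i := add_ofNat_ne i hpos (by omega)
      have hne' : i + Fin.ofNat L m + Fin.ofNat L 1 ≠ i := by
        rw [add_ofNat_add_ofNat]
        exact add_ofNat_ne i (by omega) (by omega)
      have hne2 : i + Fin.ofNat L m + Fin.ofNat L 1 ≠ i + Fin.ofNat L m :=
        add_ofNat_ne _ le_rfl (by omega)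
      obtain ⟨R0, hR0, rfl⟩ : ∃ R0, i + Fin.ofNat L m ∉ R0 ∧ R = insert (i + Fin.ofNat L m) R0 :=
        ⟨R.erase _, Finset.notMem_erase _ _, (Finset.insert_erase hR).symm⟩
      simp only [Finset.mem_insert, not_or] at hi hj
      rw [Finset.insert_comm, hf (insert i R0) _ (Finset.mem_insert.not.2 (not_or.2 ⟨hne, hR0⟩))
          (Finset.mem_insert.not.2 (not_or.2 ⟨hne', hj.2⟩)),
        Finset.insert_comm, ih (by omega) (insert (i + Fin.ofNat L m + Fin.ofNat L 1) R0)
          (Finset.mem_insert.not.2 (not_or.2 ⟨hne'.symm, hi.2⟩))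
          (Finset.mem_insert.not.2 (not_or.2 ⟨hne2.symm, hR0⟩)), Finset.insert_comm]
    · rw [ih (by omega) R hi hR, hf R _ hR hj]

lemma eq_of_card_eq [NeZero L] {α : Type*} {f : Finset (Fin L) → α}
    (hf : ∀ (R : Finset (Fin L)) i, i ∉ R → i + Fin.ofNat L 1 ∉ R →
      f (insert i R) = f (insert (i + Fin.ofNat L 1) R)) (S S' : Finset (Fin L))
    (h : S.card = S'.card) : f S = f S' := by
  induction hn : (S \ S').card generalizing S with
  | zero =>
    rw [Finset.card_eq_zero, Finset.sdiff_eq_empty_iff_subset] at hn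
    rw [Finset.eq_of_subset_of_card_le hn h.ge]
  | succ n ih =>
    obtain ⟨a, ha⟩ : (S \ S').Nonempty := by
      rw [← Finset.card_pos]
      omega
    obtain ⟨b, hb⟩ : (S' \ S).Nonempty := by
      rw [← Finset.card_pos, Finset.card_sdiff_comm h.symm]
      omega
    rw [Finset.mem_sdiff] at ha hb
    have hab : b ≠ a := by
      rintro rfl
      exact hb.2 ha.1
    obtain ⟨m, hm, rfl⟩ := exists_add_ofNat a b
    have hb' : a + Fin.ofNat L m ∉ S.erase a := fun h => hb.2 (Finset.mem_of_mem_erase h)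
    have := eq_of_insert_shift hf a m hm (S.erase a) (Finset.notMem_erase _ _) hb'
    rw [Finset.insert_erase ha.1] at this
    rw [this]
    apply ih
    · rw [Finset.card_insert_of_notMem hb', Finset.card_erase_of_mem ha.1, ← h]
      have := Finset.card_pos.2 ⟨a, ha.1⟩
      omega
    · have : insert (a + Fin.ofNat L m) (S.erase a) \ S' = (S \ S').erase a := by
        ext x
        simp only [Finset.mem_sdiff, Finset.mem_insert, Finset.mem_erase]
        constructor
        · rintro ⟨rfl | h1, h2⟩
          · exact absurd hb.1 h2
          · exact ⟨h1.1, h1.2, h2⟩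
        · rintro ⟨h1, h2, h3⟩
          exact ⟨Or.inr ⟨h1, h2⟩, h3⟩
      rw [this, Finset.card_erase_of_mem (by simp [ha]), hn, Nat.add_sub_cancel]

end Swaps

/-- If q ≠ 0 has highest charge α and lowest charge β, the product has nonzero parts of charges α +
1 and β − 1. A product of pure charge zero would need α ≤ −1 and β ≥ 1. -/
lemma eq_zero_of_chargeComp {p q : Sym L} {i j : Fin L} (hij : i ≠ j) (hp : charge p = 0)
    (h : (X (.inr i) - X (.inr j) + (X (.inl i) - X (.inl j))) * q = p) : q = 0 := by
  apply eq_zero_of_whc chargeWeight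
  intro n
  by_cases hn : 0 - 1 < n
  · refine whc_eq_zero_of_linear_mul chargeWeight (a := .inr i) (b := .inr j) (c := .inl i)
      (d := .inl j) (by simpa using hij) rfl rfl rfl rfl (m := 0) ?_ n hn
    intro n hn
    rw [h, chargeComp_eq_zero hp hn.ne']
  · rw [← neg_neg n, ← whc_neg]
    -- Reversing the weights turns the bound on the highest charge into one on the lowest.
    refine whc_eq_zero_of_linear_mul (-chargeWeight) (a := .inl i) (b := .inl j) (c := .inr i)
      (d := .inr j) (by simpa using hij) (by simp [chargeWeight]) (by simp [chargeWeight])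
      (by simp [chargeWeight]) (by simp [chargeWeight]) (m := 0) ?_ (-n) (by omega)
    intro n hn
    rw [add_comm, h, whc_neg, chargeComp_eq_zero hp (by omega)]

/-! ### The leading degrees of a conserved symbol. -/

section Analysis

lemma exists_card_notMem (a : Fin L) {n : ℕ} (hn : n < L) :
    ∃ S : Finset (Fin L), a ∉ S ∧ S.card = n := by
  obtain ⟨S, hS, hc⟩ := Finset.exists_subset_card_eq
    (s := Finset.univ.erase a) (n := n) (by simp; omega)
  exact ⟨S, fun h' => by simpa using hS h', hc⟩

lemma sum_hop_of_offDiag {T : Finset (Fin L) → Finset (Fin L) → ℂ}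
    {F : Finset (Fin L) → Finset (Fin L) → Sym L} {n : ℤ}
    (hn : ∀ S S', S ≠ S' → comp n (F S S') = 0)
    (S S' : Finset (Fin L)) :
    ∑ R, (C (T R S') * comp n (F S R) - C (T S R) * comp n (F R S')) =
      C (T S S') * (comp n (F S S) - comp n (F S' S')) := by
  rw [Finset.sum_sub_distrib, Finset.sum_eq_single S, Finset.sum_eq_single S', mul_sub]
  · intro R _ hR
    rw [hn _ _ hR, mul_zero]
  · simp
  · intro R _ hR
    rw [hn _ _ hR.symm, mul_zero]
  · simp

variable [NeZero L] {g ω μ : ℂ} {T : Finset (Fin L) → Finset (Fin L) → ℂ} {h : ℕ}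
  {F : Finset (Fin L) → Finset (Fin L) → Sym L}

section

variable (hg : g ≠ 0) (hF : Constraints g ω μ T h F) {D : ℤ}
  (hD : ∀ n, D < n → ∀ S S', comp n (F S S') = 0)

include hg hF hD

/-- In degree D + 1 the only surviving term is multiplication by `field S' - field S`, a nonzero
form. -/
lemma comp_top_offDiag {S S' : Finset (Fin L)} (hS : S ≠ S') : comp D (F S S') = 0 := by
  have := comp_symComm g ω μ T F S S' (D + 1)
  rw [hF.comm, map_zero] at this
  simp only [hD (D + 1) (by omega), hD (D + 1 + 1) (by omega), map_zero, mul_zero, sub_zero,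
    Finset.sum_const_zero, add_zero, add_sub_cancel_right] at this
  have h1 := mul_eq_zero.1 this.symm
  simpa [hg, field_ne hS] using h1

lemma charge_comp_top (hω : ω ≠ 0) (S : Finset (Fin L)) : charge (comp D (F S S)) = 0 := by
  have := comp_symComm g ω μ T F S S D
  rw [sum_hop_of_offDiag (fun S S' => comp_top_offDiag hg hF hD), hF.comm, map_zero] at this
  simp only [hD (D + 1) (by omega), map_zero, mul_zero, sub_self, zero_mul,
    Finset.sum_const_zero, add_zero, zero_add] at this
  simpa [hω] using this.symm

/-- In degree D off the diagonal, the coupling acting on degree D − 1 balances the hopping between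
the diagonal top parts. -/
lemma top_hop {S S' : Finset (Fin L)} (hS : S ≠ S') :
    C g * ((field S' - field S) * comp (D - 1) (F S S')) +
      C (T S S') * (comp D (F S S) - comp D (F S' S')) = 0 := by
  have := comp_symComm g ω μ T F S S' D
  rw [sum_hop_of_offDiag (fun S S' => comp_top_offDiag hg hF hD), hF.comm, map_zero] at this
  simp only [hD (D + 1) (by omega), comp_top_offDiag hg hF hD hS, map_zero, mul_zero, sub_zero,
    Finset.sum_const_zero, add_zero] at this
  exact this.symm

variable (hω : ω ≠ 0) (hL : 2 ≤ L) (hT : ∀ (R : Finset (Fin L)) i, i ∉ R → i + Fin.ofNat L 1 ∉ R →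
  T (insert i R) (insert (i + Fin.ofNat L 1) R) ≠ 0)

include hω hL hT

/-- `top_hop` exhibits the difference, which has charge zero, as a multiple of a form with parts of
charge 1 and −1; hence it vanishes. -/
lemma comp_top_insert (R : Finset (Fin L)) (i : Fin L) (hi : i ∉ R) (hj : i + Fin.ofNat L 1 ∉ R) :
    comp D (F (insert i R) (insert i R)) =
      comp D (F (insert (i + Fin.ofNat L 1) R) (insert (i + Fin.ofNat L 1) R)) := by
  have hne : i ≠ i + Fin.ofNat L 1 := (add_ofNat_ne i le_rfl (by omega)).symm
  have hS : insert i R ≠ insert (i + Fin.ofNat L 1) R := by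
    intro h'
    have := h' ▸ Finset.mem_insert_self i R
    simp only [Finset.mem_insert, hi, hne, or_false] at this
  have h1 := top_hop hg hF hD hS
  rw [field_insert_sub hi hj] at h1
  have h2 : (X (.inr i) - X (.inr (i + Fin.ofNat L 1)) +
      (X (.inl i) - X (.inl (i + Fin.ofNat L 1)))) *
        (C g * comp (D - 1) (F (insert i R) (insert (i + Fin.ofNat L 1) R))) =
      C (T (insert i R) (insert (i + Fin.ofNat L 1) R)) *
        (comp D (F (insert i R) (insert i R)) -
          comp D (F (insert (i + Fin.ofNat L 1) R) (insert (i + Fin.ofNat L 1) R))) := by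
    linear_combination -h1
  have h3 := eq_zero_of_chargeComp hne (p := _) (by
    rw [C_mul', map_smul, map_sub, charge_comp_top hg hF hD hω, charge_comp_top hg hF hD hω,
      sub_zero, smul_zero]) h2
  rw [h3, mul_zero] at h2
  have h4 := mul_eq_zero.1 h2.symm
  rw [C_eq_zero] at h4
  exact sub_eq_zero.1 (h4.resolve_left (hT R i hi hj))

lemma comp_top_card {S S' : Finset (Fin L)} (hS : S.card = S'.card) :
    comp D (F S S) = comp D (F S' S') :=
  eq_of_card_eq (f := fun S => comp D (F S S)) (comp_top_insert hg hF hD hω hL hT) S S' hS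

/-- For each variable v, adding a particle at distance h from the site of v does not change ∂_v of
the top part. As only the particle number matters, that site may be chosen anew for each v, so all
derivatives of the change vanish; in nonzero degree the change itself is then zero. -/
lemma comp_top_eq (hD0 : D ≠ 0) (S : Finset (Fin L)) : comp D (F S S) = comp D (F ∅ ∅) := by
  induction hn : S.card generalizing S with
  | zero =>
    rw [Finset.card_eq_zero.1 hn]
  | succ n ih =>
    rw [← sub_eq_zero]
    apply eq_zero_of_pderiv_eq_zero hD0
    · simp only [map_sub, whc_whc, if_true]
    · intro v
      have hnL : n < L := by
        have := Finset.card_le_univ S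
        rw [Fintype.card_fin] at this
        omega
      obtain ⟨S0, ha, hc⟩ := exists_card_notMem
        (Sum.elim id id v + Fin.ofNat L h) hnL
      have h1 : S0 ∆ {Sum.elim id id v + Fin.ofNat L h} =
          insert (Sum.elim id id v + Fin.ofNat L h) S0 := by
        ext x
        simp only [Finset.mem_symmDiff, Finset.mem_singleton, Finset.mem_insert]
        constructor
        · rintro (⟨h1, h2⟩ | ⟨h1, h2⟩)
          · exact Or.inr h1
          · exact Or.inl h1
        · rintro (rfl | h1)
          · exact Or.inr ⟨rfl, ha⟩
          · exact Or.inl ⟨h1, by rintro rfl; exact ha h1⟩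
      have h2 := congrArg (comp (D - 1)) (hF.flip S0 _ v rfl)
      rw [comp_pderiv, sub_add_cancel, map_zero, map_sub, h1,
        comp_top_card hg hF hD hω hL hT (S' := S)
          (by rw [Finset.card_insert_of_notMem ha, hc, hn]), ih S0 hc] at h2
      exact h2

lemma comp_sub_one_offDiag (hD0 : D ≠ 0) {S S' : Finset (Fin L)} (hS : S ≠ S') :
    comp (D - 1) (F S S') = 0 := by
  have h1 := top_hop hg hF hD hS
  rw [comp_top_eq hg hF hD hω hL hT hD0 S, comp_top_eq hg hF hD hω hL hT hD0 S', sub_self,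
    mul_zero, add_zero] at h1
  have h1 := mul_eq_zero.1 h1
  simpa [hg, field_ne hS] using h1

/-- On the diagonal in degree D − 1, the phonon energy must compensate the derivative part of the
coupling acting on the top part. -/
lemma charge_comp_sub_one (hD0 : D ≠ 0) (i : Fin L) :
    charge (comp (D - 1) (F {i} {i})) =
      C (g / ω) * (pderiv (.inl i) (comp D (F ∅ ∅)) - pderiv (.inr i) (comp D (F ∅ ∅))) := by
  have := comp_symComm g ω μ T F {i} {i} (D - 1)
  rw [sum_hop_of_offDiag (fun S S' => comp_sub_one_offDiag hg hF hD hω hL hT hD0), hF.comm,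
    map_zero] at this
  simp only [sub_self, zero_mul, mul_zero, zero_add, add_zero, sub_add_cancel, C_0,
    Finset.sum_singleton, comp_top_eq hg hF hD hω hL hT hD0 {i}] at this
  have hC : (C ω : Sym L) ≠ 0 := by simpa using hω
  apply mul_left_cancel₀ hC
  rw [← mul_assoc, ← C_mul, mul_div_cancel₀ _ hω]
  linear_combination -this

lemma sub_one_hop (hD0 : D ≠ 0) {S S' : Finset (Fin L)} (hS : S ≠ S') :
    C g * ((field S' - field S) * comp (D - 1 - 1) (F S S')) +
      C (T S S') * (comp (D - 1) (F S S) - comp (D - 1) (F S' S')) = 0 := by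
  have := comp_symComm g ω μ T F S S' (D - 1)
  rw [sum_hop_of_offDiag (fun S S' => comp_sub_one_offDiag hg hF hD hω hL hT hD0), hF.comm,
    map_zero] at this
  simp only [sub_add_cancel, comp_top_offDiag hg hF hD hS,
    comp_sub_one_offDiag hg hF hD hω hL hT hD0 hS, map_zero, mul_zero, sub_zero,
    Finset.sum_const_zero, add_zero] at this
  exact this.symm

/-- R below is the difference of the degree D − 1 parts at two neighbours. By `sub_one_hop` it is a
linear form times a polynomial `q0`, while `charge_comp_sub_one` gives its charged parts as
gradients of p. Matching charges 1 and −1 yields the two equations. -/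
lemma exists_gradient (hD0 : D ≠ 0) (i : Fin L) : ∃ q : Sym L,
    pderiv (.inr i) (comp D (F ∅ ∅)) - pderiv (.inr (i + Fin.ofNat L 1)) (comp D (F ∅ ∅)) =
      (X (.inl i) - X (.inl (i + Fin.ofNat L 1))) * q ∧
    pderiv (.inl i) (comp D (F ∅ ∅)) - pderiv (.inl (i + Fin.ofNat L 1)) (comp D (F ∅ ∅)) =
      (X (.inr i) - X (.inr (i + Fin.ofNat L 1))) * q := by
  set p := comp D (F ∅ ∅) with hp
  have hp0 : charge p = 0 := charge_comp_top hg hF hD hω ∅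
  set j := i + Fin.ofNat L 1 with hj
  have hne : i ≠ j := (add_ofNat_ne i le_rfl (by omega)).symm
  have hT0 : T {i} {j} ≠ 0 := hT ∅ i (Finset.notMem_empty _) (Finset.notMem_empty _)
  have h1 := sub_one_hop hg hF hD hω hL hT hD0 (S := {i}) (S' := {j}) (by simpa using hne)
  have h2 := field_insert_sub (R := ∅) (i := i) (j := j) (by simp) (by simp)
  simp only [insert_empty_eq] at h2
  rw [h2] at h1
  set R := comp (D - 1) (F {i} {i}) - comp (D - 1) (F {j} {j}) with hR
  set q0 := C (g / T {i} {j}) * comp (D - 1 - 1) (F {i} {j}) with hq0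
  have h3 : (X (.inr i) - X (.inr j) + (X (.inl i) - X (.inl j))) * q0 = R := by
    have hC : (C (T {i} {j}) : Sym L) ≠ 0 := by simpa using hT0
    apply mul_left_cancel₀ hC
    have : (C (T {i} {j}) : Sym L) * C (g / T {i} {j}) = C g := by
      rw [← C_mul, mul_div_cancel₀ _ hT0]
    rw [hq0]
    linear_combination (X (.inr i) - X (.inr j) + (X (.inl i) - X (.inl j))) *
      comp (D - 1 - 1) (F {i} {j}) * this - h1
  have h4 : charge R = C (g / ω) * (pderiv (.inl i) p - pderiv (.inl j) p -
      (pderiv (.inr i) p - pderiv (.inr j) p)) := by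
    rw [hR, map_sub, charge_comp_sub_one hg hF hD hω hL hT hD0,
      charge_comp_sub_one hg hF hD hω hL hT hD0]
    ring
  -- Since p has charge zero, differentiating in b† leaves charge 1 and differentiating in b leaves
  -- charge −1.
  have hinl : ∀ (n : ℤ) (k : Fin L), chargeComp n (pderiv (.inl k) p) =
      if n = 1 then pderiv (.inl k) p else 0 := by
    intro n k
    rw [whc_pderiv]
    split_ifs with hn
    · rw [hn, show (1 : ℤ) + chargeWeight (Sum.inl k) = 0 from rfl, chargeComp_zero_eq hp0]
    · rw [chargeComp_eq_zero hp0, map_zero]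
      simp only [chargeWeight, Sum.elim_inl]
      omega
  have hinr : ∀ (n : ℤ) (k : Fin L), chargeComp n (pderiv (.inr k) p) =
      if n = -1 then pderiv (.inr k) p else 0 := by
    intro n k
    rw [whc_pderiv]
    split_ifs with hn
    · rw [hn, show (-1 : ℤ) + chargeWeight (Sum.inr k) = 0 from rfl, chargeComp_zero_eq hp0]
    · rw [chargeComp_eq_zero hp0, map_zero]
      simp only [chargeWeight, Sum.elim_inr]
      omega
  have h5 : ∀ n : ℤ, C (n : ℂ) * chargeComp n R = C (g / ω) *
      ((if n = 1 then pderiv (.inl i) p - pderiv (.inl j) p else 0) -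
      (if n = -1 then pderiv (.inr i) p - pderiv (.inr j) p else 0)) := by
    intro n
    rw [← chargeComp_charge, h4, weightedHomogeneousComponent_C_mul]
    simp only [map_sub, hinl, hinr]
    split_ifs <;> simp
  have h6 : ∀ n : ℤ, n ≠ 0 → n ≠ 1 → n ≠ -1 → chargeComp n R = 0 := by
    intro n hn0 hn1 hn2
    have := h5 n
    simpa [hn0, hn1, hn2] using this
  -- R has charges in {−1, 0, 1} only, and the linear form widens the range of charges by one on
  -- each side, so `q0` has pure charge 0.
  have hup : ∀ n : ℤ, 0 < n → chargeComp n q0 = 0 := by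
    intro n hn
    refine whc_eq_zero_of_linear_mul chargeWeight (a := .inr i) (b := .inr j) (c := .inl i)
      (d := .inl j) (by simpa using hne) rfl rfl rfl rfl (m := 1) ?_ n (by omega)
    intro n hn
    rw [h3, h6 n (by omega) (by omega) (by omega)]
  have hdown : ∀ n : ℤ, n < 0 → chargeComp n q0 = 0 := by
    intro n hn
    rw [← neg_neg n, ← whc_neg]
    refine whc_eq_zero_of_linear_mul (-chargeWeight) (a := .inl i) (b := .inl j) (c := .inr i)
      (d := .inr j) (by simpa using hne) (by simp [chargeWeight]) (by simp [chargeWeight])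
      (by simp [chargeWeight]) (by simp [chargeWeight]) (m := 1) ?_ (-n) (by omega)
    intro n hn
    rw [add_comm, h3, whc_neg, h6 (-n) (by omega) (by omega) (by omega)]
  have hmul : ∀ n : ℤ, chargeComp n R = (X (.inr i) - X (.inr j)) * chargeComp (n - 1) q0 +
      (X (.inl i) - X (.inl j)) * chargeComp (n + 1) q0 := by
    intro n
    rw [← h3, add_mul, sub_mul, sub_mul, map_add, map_sub, map_sub]
    simp only [whc_X_mul, show ∀ k : Fin L, chargeWeight (Sum.inl k) = -1 from fun _ => rfl,
      show ∀ k : Fin L, chargeWeight (Sum.inr k) = 1 from fun _ => rfl, sub_neg_eq_add]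
    ring
  have k1 := h5 1
  have k2 := h5 (-1)
  rw [hmul, sub_self, show (1 : ℤ) + 1 = 2 from rfl, hup 2 (by norm_num)] at k1
  rw [hmul, show (-1 : ℤ) - 1 = -2 from rfl, show (-1 : ℤ) + 1 = 0 from rfl,
    hdown (-2) (by norm_num)] at k2
  have hgω : (C (ω / g) : Sym L) * C (g / ω) = 1 := by
    rw [← C_mul, div_mul_div_cancel₀ hg, div_self hω, C_1]
  refine ⟨C (ω / g) * chargeComp 0 q0, ?_, ?_⟩
  · simp only [show (-1 : ℤ) ≠ 1 by norm_num, if_true, if_false, Int.cast_neg, Int.cast_one, C_neg,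
      C_1, mul_zero, zero_sub, zero_add] at k2
    linear_combination C (ω / g) * k2 -
      (pderiv (.inr i) p - pderiv (.inr j) p) * hgω
  · simp only [show (1 : ℤ) ≠ -1 by norm_num, if_true, if_false, Int.cast_one, C_1, mul_zero,
      sub_zero, add_zero, one_mul] at k1
    linear_combination -C (ω / g) * k1 -
      (pderiv (.inl i) p - pderiv (.inl j) p) * hgω

variable (h1 : h < L) (h2 : L ≤ 2 * h + 1)

include h1 h2

/-- Charge zero excludes linear terms, so the classification applies to the common top part;
homogeneity of nonzero degree removes the constant and leaves only D = 2. -/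
theorem exists_comp_top_eq (hD0 : D ≠ 0) :
    ∃ s : ℂ, ∀ S S', comp D (F S S') =
      if S = S' ∧ D = 2 then C s * numberSymbol (Fin L) else 0 := by
  choose q hz hy using exists_gradient hg hF hD hω hL hT hD0
  have hM : ∀ i, MixedZero (comp D (F ∅ ∅)) i (i + Fin.ofNat L h) := by
    intro i v w hv hw
    have := congrArg (comp (D - 1 - 1)) (hF.mixed ∅ ∅ i v w hv hw)
    rwa [comp_pderiv, comp_pderiv, map_zero, sub_add_cancel, sub_add_cancel] at this
  obtain ⟨s, c, hs⟩ := eq_numberSymbol_add_const hL hz hy h1 h2 hM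
    (coeff_single_eq_zero (charge_comp_top hg hF hD hω ∅))
  refine ⟨s, fun S S' => ?_⟩
  by_cases hS : S = S'
  · subst hS
    rw [comp_top_eq hg hF hD hω hL hT hD0]
    have := congrArg (comp D) hs
    rw [whc_whc, if_pos rfl, map_add, weightedHomogeneousComponent_C_mul, comp_numberSymbol,
      comp_C, if_neg hD0, add_zero] at this
    rw [this]
    by_cases h2 : D = 2 <;> simp [h2]
  · rw [comp_top_offDiag hg hF hD hS, if_neg (fun h' => hS h'.1)]

end

end Analysis

/-! ### Phonon operators and normal-ordered quantization. -/

/-- The phonon Fock space. -/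
abbrev PhononFock (L : ℕ) : Type := (Fin L → ℕ) →₀ ℂ

/-- Operators on the phonon Fock space. -/
abbrev PhononOp (L : ℕ) : Type := Module.End ℂ (PhononFock L)

noncomputable instance (L : ℕ) : Ring (PhononOp L) := inferInstance

/-- The phonon annihilation operator on the phonon Fock space. -/
noncomputable def low (i : Fin L) : PhononOp L :=
  Finsupp.linearCombination ℂ (fun m : Fin L → ℕ =>
    Finsupp.single (Function.update m i (m i - 1)) ((Real.sqrt (m i : ℝ) : ℝ) : ℂ))

/-- The phonon creation operator on the phonon Fock space. -/
noncomputable def up (i : Fin L) : PhononOp L :=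
  Finsupp.linearCombination ℂ (fun m : Fin L → ℕ =>
    Finsupp.single (Function.update m i (m i + 1)) ((Real.sqrt ((m i : ℝ) + 1) : ℝ) : ℂ))

lemma low_single (i : Fin L) (m : Fin L → ℕ) (z : ℂ) : low i (Finsupp.single m z) =
    Finsupp.single (Function.update m i (m i - 1)) (z * ((Real.sqrt (m i : ℝ) : ℝ) : ℂ)) := by
  simp [low]

lemma up_single (i : Fin L) (m : Fin L → ℕ) (z : ℂ) : up i (Finsupp.single m z) =
    Finsupp.single (Function.update m i (m i + 1))
      (z * ((Real.sqrt ((m i : ℝ) + 1) : ℝ) : ℂ)) := by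
  simp [up]

lemma up_mul_up (i j : Fin L) : up i * up j = up j * up i := by
  refine Finsupp.lhom_ext fun m z => ?_
  simp only [Module.End.mul_apply, up_single]
  by_cases h : i = j
  · rw [h]
  · rw [Function.update_of_ne h, Function.update_of_ne (Ne.symm h), Function.update_comm h]
    congr 1
    ring

lemma low_mul_low (i j : Fin L) : low i * low j = low j * low i := by
  refine Finsupp.lhom_ext fun m z => ?_
  simp only [Module.End.mul_apply, low_single]
  by_cases h : i = j
  · rw [h]
  · rw [Function.update_of_ne h, Function.update_of_ne (Ne.symm h), Function.update_comm h]
    congr 1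
    ring

lemma low_mul_up_of_ne {i j : Fin L} (h : i ≠ j) : low i * up j = up j * low i := by
  refine Finsupp.lhom_ext fun m z => ?_
  simp only [Module.End.mul_apply, low_single, up_single]
  rw [Function.update_of_ne h, Function.update_of_ne (Ne.symm h), Function.update_comm h]
  congr 1
  ring

lemma sqrt_mul_sqrt_cast (x : ℝ) (hx : 0 ≤ x) :
    ((Real.sqrt x : ℝ) : ℂ) * ((Real.sqrt x : ℝ) : ℂ) = x := by
  rw [← Complex.ofReal_mul, Real.mul_self_sqrt hx]

lemma low_mul_up_self (i : Fin L) : low i * up i = up i * low i + 1 := by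
  refine Finsupp.lhom_ext fun m z => ?_
  simp only [Module.End.mul_apply, low_single, up_single, LinearMap.add_apply,
    Module.End.one_apply, Function.update_self, Function.update_idem]
  have h0 : (0 : ℝ) ≤ (m i : ℝ) + 1 := by positivity
  have hs := sqrt_mul_sqrt_cast _ h0
  have h1 : Function.update m i (m i + 1 - 1) = m := by simp
  rw [h1]
  push_cast
  rcases Nat.eq_zero_or_pos (m i) with h | h
  -- At m i = 0 the truncated subtraction in `low` does no harm, because its coefficient √0
  -- vanishes.
  · simp [h]
  · have h2 : Function.update m i (m i - 1 + 1) = m := by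
      rw [Nat.sub_add_cancel h]
      simp
    have h3 : ((m i - 1 : ℕ) : ℝ) + 1 = m i := by
      exact_mod_cast Nat.sub_add_cancel h
    rw [h2, h3, ← Finsupp.single_add, mul_assoc, mul_assoc, hs,
      sqrt_mul_sqrt_cast _ (by positivity)]
    congr 1
    push_cast
    ring

lemma low_mul_up [DecidableEq (Fin L)] (i j : Fin L) :
    low i * up j = up j * low i + if i = j then 1 else 0 := by
  split_ifs with h
  · rw [h, low_mul_up_self]
  · rw [low_mul_up_of_ne h, add_zero]

/-- Left multiplication by a creation operator or right multiplication by an annihilation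
operator. -/
noncomputable def normalMul : Fin L ⊕ Fin L → Module.End ℂ (PhononOp L) :=
  Sum.elim (fun j => LinearMap.mulLeft ℂ (up j)) (fun j => LinearMap.mulRight ℂ (low j))

lemma normalMul_comm (v w : Fin L ⊕ Fin L) :
    normalMul v * normalMul w = normalMul w * normalMul v := by
  refine LinearMap.ext fun A => ?_
  rcases v with i | i <;> rcases w with j | j
  · change up i * (up j * A) = up j * (up i * A)
    rw [← mul_assoc, up_mul_up, mul_assoc]
  · change up i * (A * low j) = up i * A * low j
    rw [mul_assoc]
  · change up j * A * low i = up j * (A * low i)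
    rw [mul_assoc]
  · change A * low j * low i = A * low i * low j
    rw [mul_assoc, low_mul_low, mul_assoc]

/-- Polynomial evaluation needs a commutative target: the subalgebra generated by the commuting
elements is one. -/
lemma exists_aeval_of_commute {σ A : Type*} [Ring A] [Algebra ℂ A] (f : σ → A)
    (hf : ∀ v w, f v * f w = f w * f v) :
    ∃ φ : MvPolynomial σ ℂ →ₐ[ℂ] A, ∀ v, φ (X v) = f v := by
  let B := Algebra.adjoin ℂ (Set.range f)
  let _ : CommRing B := { (inferInstance : Ring B) with
    mul_comm := by
      have : ∀ a ∈ Set.range f, ∀ b ∈ Set.range f, a * b = b * a := by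
        rintro _ ⟨v, rfl⟩ _ ⟨w, rfl⟩
        exact hf v w
      exact (Algebra.isMulCommutative_adjoin ℂ this).is_comm.comm }
  refine ⟨(B.val : B →ₐ[ℂ] A).comp (aeval fun v => (⟨f v, Algebra.subset_adjoin ⟨v, rfl⟩⟩ : B)), ?_⟩
  intro v
  simp [B]

/-- The action of normal-ordered symbols on phonon operators. -/
noncomputable def quantHom : Sym L →ₐ[ℂ] Module.End ℂ (PhononOp L) :=
  (exists_aeval_of_commute (normalMul (L := L)) normalMul_comm).choose

lemma quantHom_X (v : Fin L ⊕ Fin L) : quantHom (X v) = normalMul v :=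
  (exists_aeval_of_commute (normalMul (L := L)) normalMul_comm).choose_spec v

/-- Normal-ordered quantization. -/
noncomputable def quant : Sym L →ₗ[ℂ] PhononOp L :=
  LinearMap.applyₗ (1 : PhononOp L) ∘ₗ quantHom.toLinearMap

lemma quant_X_mul (v : Fin L ⊕ Fin L) (p : Sym L) :
    quant (X v * p) = normalMul v (quant p) := by
  change quantHom (X v * p) 1 = _
  rw [map_mul, quantHom_X]
  rfl

lemma quant_inl_mul (j : Fin L) (p : Sym L) : quant (X (.inl j) * p) = up j * quant p :=
  quant_X_mul _ _

lemma quant_inr_mul (j : Fin L) (p : Sym L) : quant (X (.inr j) * p) = quant p * low j :=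
  quant_X_mul _ _

lemma quant_C (z : ℂ) : quant (C z : Sym L) = z • 1 := by
  simp [quant, ← algebraMap_eq, Algebra.algebraMap_eq_smul_one]

/-- Carrying b_j through a normal-ordered product to its place on the right costs a commutator,
which is the derivative in b†_j. -/
lemma low_mul_quant (j : Fin L) (p : Sym L) :
    low j * quant p = quant (X (Sum.inr j) * p + pderiv (Sum.inl j) p) := by
  induction p using MvPolynomial.induction_on with
  | C a =>
    rw [pderiv_C, add_zero, quant_inr_mul, quant_C]
    simp
  | add p q hp hq =>
    rw [map_add, mul_add, hp, hq, ← map_add, map_add (pderiv _)]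
    rw [add_add_add_comm, ← mul_add]
  | mul_X p v hp =>
    rw [mul_comm p, Derivation.leibniz, smul_eq_mul, smul_eq_mul]
    rcases v with i | i
    · have : (X (Sum.inr j) * (X (Sum.inl i) * p) + (X (Sum.inl i) * pderiv (Sum.inl j) p +
          p * pderiv (Sum.inl j) (X (Sum.inl i))) : Sym L) =
          X (Sum.inl i) * (X (Sum.inr j) * p + pderiv (Sum.inl j) p) +
            p * pderiv (Sum.inl j) (X (Sum.inl i)) := by
        ring
      rw [this, map_add, quant_inl_mul, quant_inl_mul, ← hp, ← mul_assoc, low_mul_up, add_mul,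
        mul_assoc]
      by_cases h : j = i
      · subst h
        simp
      · rw [if_neg h, pderiv_X_of_ne (by simpa using Ne.symm h)]
        simp
    · have : (X (Sum.inr j) * (X (Sum.inr i) * p) + (X (Sum.inr i) * pderiv (Sum.inl j) p +
          p * pderiv (Sum.inl j) (X (Sum.inr i))) : Sym L) =
          X (Sum.inr i) * (X (Sum.inr j) * p + pderiv (Sum.inl j) p) := by
        rw [pderiv_X_of_ne (by simp)]
        ring
      rw [this, quant_inr_mul, quant_inr_mul, ← hp, mul_assoc]

lemma quant_mul_up (j : Fin L) (p : Sym L) :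
    quant p * up j = quant (X (Sum.inl j) * p + pderiv (Sum.inr j) p) := by
  induction p using MvPolynomial.induction_on with
  | C a =>
    rw [pderiv_C, add_zero, quant_inl_mul, quant_C]
    simp
  | add p q hp hq =>
    rw [map_add, add_mul, hp, hq, ← map_add, map_add (pderiv _)]
    rw [add_add_add_comm, ← mul_add]
  | mul_X p v hp =>
    rw [mul_comm p, Derivation.leibniz, smul_eq_mul, smul_eq_mul]
    rcases v with i | i
    · have : (X (Sum.inl j) * (X (Sum.inl i) * p) + (X (Sum.inl i) * pderiv (Sum.inr j) p +
          p * pderiv (Sum.inr j) (X (Sum.inl i))) : Sym L) =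
          X (Sum.inl i) * (X (Sum.inl j) * p + pderiv (Sum.inr j) p) := by
        rw [pderiv_X_of_ne (by simp)]
        ring
      rw [this, quant_inl_mul, quant_inl_mul, ← hp, mul_assoc]
    · have : (X (Sum.inl j) * (X (Sum.inr i) * p) + (X (Sum.inr i) * pderiv (Sum.inr j) p +
          p * pderiv (Sum.inr j) (X (Sum.inr i))) : Sym L) =
          X (Sum.inr i) * (X (Sum.inl j) * p + pderiv (Sum.inr j) p) +
            p * pderiv (Sum.inr j) (X (Sum.inr i)) := by
        ring
      rw [this, map_add, quant_inr_mul, quant_inr_mul, ← hp, mul_assoc, low_mul_up, mul_add,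
        mul_assoc]
      by_cases h : i = j
      · subst h
        simp
      · rw [if_neg h, pderiv_X_of_ne (by simpa using h)]
        simp

lemma quant_pderiv_inl (j : Fin L) (p : Sym L) :
    quant (pderiv (.inl j) p) = low j * quant p - quant p * low j := by
  rw [low_mul_quant, map_add, quant_inr_mul, add_sub_cancel_left]

lemma quant_pderiv_inr (j : Fin L) (p : Sym L) :
    quant (pderiv (.inr j) p) = quant p * up j - up j * quant p := by
  rw [quant_mul_up, map_add, quant_inl_mul, add_sub_cancel_left]

lemma totalDegree_pderiv_lt {σ : Type*} (v : σ) (p : MvPolynomial σ ℂ) (h : pderiv v p ≠ 0) :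
    (pderiv v p).totalDegree < p.totalDegree := by
  classical
  obtain ⟨e, he, hd⟩ := Finset.exists_mem_eq_sup _ (support_nonempty.2 h)
    (fun e : σ →₀ ℕ => e.sum fun _ n => n)
  have he' : coeff (e + Finsupp.single v 1) p ≠ 0 := by
    rw [mem_support_iff, coeff_pderiv] at he
    exact left_ne_zero_of_mul he
  have h1 := le_totalDegree (mem_support_iff.2 he')
  rw [Finsupp.sum_add_index' (by simp) (by simp)] at h1
  simp only [Finsupp.sum_single_index] at h1
  have h2 : (pderiv v p).totalDegree = e.sum fun _ n => n := hd
  omega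

/-- Derivatives of a symbol quantize to commutators, so the kernel is stable under differentiation.
By induction on the degree a kernel element is constant, and the vacuum state detects constants. -/
theorem quant_injective : Function.Injective (quant : Sym L →ₗ[ℂ] PhononOp L) := by
  rw [injective_iff_map_eq_zero]
  intro p hp
  induction hd : p.totalDegree using Nat.strong_induction_on generalizing p with
  | _ d ih =>
    have h1 : ∀ v, pderiv v p = 0 := by
      intro v
      by_contra hne
      refine hne (ih _ (hd ▸ totalDegree_pderiv_lt v p hne) _ ?_ rfl)
      rcases v with j | j
      · rw [quant_pderiv_inl, hp, mul_zero, zero_mul, sub_self]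
      · rw [quant_pderiv_inr, hp, mul_zero, zero_mul, sub_self]
    rw [eq_C_of_pderiv_eq_zero h1, quant_C] at hp
    rw [eq_C_of_pderiv_eq_zero h1]
    have : coeff 0 p = 0 := by
      have := congrArg (fun A : PhononOp L => A (Finsupp.single 0 1) 0) hp
      simpa using this
    rw [this, C_0]

/-- Strip variables from p one at a time: a creation operator stays on the left of everything, an
annihilation operator is absorbed into A by `low_mul_quant`. -/
lemma quant_mul_mem_range (p : Sym L) (A : PhononOp L) (hA : A ∈ LinearMap.range (quant (L := L))) :
    quant p * A ∈ LinearMap.range (quant (L := L)) := by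
  induction p using MvPolynomial.induction_on generalizing A with
  | C a =>
    rw [quant_C, smul_mul_assoc, one_mul]
    exact Submodule.smul_mem _ _ hA
  | add p q hp hq =>
    rw [map_add, add_mul]
    exact Submodule.add_mem _ (hp A hA) (hq A hA)
  | mul_X p v hp =>
    rw [mul_comm p]
    rcases v with i | i
    · obtain ⟨q, hq⟩ := hp A hA
      rw [quant_inl_mul, mul_assoc, ← hq, ← quant_inl_mul]
      exact ⟨_, rfl⟩
    · obtain ⟨q, rfl⟩ := hA
      rw [quant_inr_mul, mul_assoc, low_mul_quant]
      exact hp _ ⟨_, rfl⟩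

/-! ### Blocks of operators between fermion configurations. -/

noncomputable instance (L : ℕ) : Ring (Op L) := inferInstance

lemma c_single (i : Fin L) (S : Finset (Fin L)) (m : Fin L → ℕ) (z : ℂ) :
    c i (Finsupp.single ((S, m) : Config L) z) =
      if i ∈ S then Finsupp.single ((S.erase i, m) : Config L) (z * fermiSign S i) else 0 := by
  rw [c, Finsupp.linearCombination_single]
  split_ifs <;> simp_all

lemma cDag_single (i : Fin L) (S : Finset (Fin L)) (m : Fin L → ℕ) (z : ℂ) :
    cDag i (Finsupp.single ((S, m) : Config L) z) =
      if i ∈ S then 0 else Finsupp.single ((insert i S, m) : Config L) (z * fermiSign S i) := by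
  rw [cDag, Finsupp.linearCombination_single]
  split_ifs <;> simp_all

lemma b_single (i : Fin L) (S : Finset (Fin L)) (m : Fin L → ℕ) (z : ℂ) :
    b i (Finsupp.single ((S, m) : Config L) z) =
      Finsupp.single ((S, Function.update m i (m i - 1)) : Config L)
        (z * ((Real.sqrt (m i : ℝ) : ℝ) : ℂ)) := by
  rw [b, Finsupp.linearCombination_single]
  simp

lemma bDag_single (i : Fin L) (S : Finset (Fin L)) (m : Fin L → ℕ) (z : ℂ) :
    bDag i (Finsupp.single ((S, m) : Config L) z) =
      Finsupp.single ((S, Function.update m i (m i + 1)) : Config L)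
        (z * ((Real.sqrt ((m i : ℝ) + 1) : ℝ) : ℂ)) := by
  rw [bDag, Finsupp.linearCombination_single]
  simp

lemma fermiSign_mul_self (S : Finset (Fin L)) (i : Fin L) : fermiSign S i * fermiSign S i = 1 := by
  rw [fermiSign, ← mul_pow]
  simp

lemma fermiSign_erase_self (S : Finset (Fin L)) (i : Fin L) :
    fermiSign (S.erase i) i = fermiSign S i := by
  rw [fermiSign, fermiSign]
  congr 2
  ext j
  simp only [Finset.mem_filter, Finset.mem_erase]
  exact ⟨fun h => ⟨h.1.2, h.2⟩, fun h => ⟨⟨h.2.ne, h.1⟩, h.2⟩⟩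

lemma num_single (i : Fin L) (S : Finset (Fin L)) (m : Fin L → ℕ) (z : ℂ) :
    num i (Finsupp.single ((S, m) : Config L) z) =
      if i ∈ S then Finsupp.single ((S, m) : Config L) z else 0 := by
  rw [num, Module.End.mul_apply, c_single]
  split_ifs with h
  · rw [cDag_single, if_neg (Finset.notMem_erase _ _), Finset.insert_erase h,
      fermiSign_erase_self, mul_assoc, fermiSign_mul_self, mul_one]
  · rw [map_zero]

lemma op_ext {A B : Op L} (h : ∀ S m z, A (Finsupp.single ((S, m) : Config L) z) =
    B (Finsupp.single ((S, m) : Config L) z)) : A = B :=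
  Finsupp.lhom_ext fun s z => h s.1 s.2 z

/-- The inclusion of the sector with fermion configuration `S`. -/
noncomputable def incl (S : Finset (Fin L)) : PhononFock L →ₗ[ℂ] Fock L :=
  Finsupp.lmapDomain ℂ ℂ (fun m => ((S, m) : Config L))

/-- The projection to the sector with fermion configuration `S`. -/
noncomputable def proj (S : Finset (Fin L)) : Fock L →ₗ[ℂ] PhononFock L :=
  Finsupp.lcomapDomain (fun m => ((S, m) : Config L)) (Prod.mk_right_injective S)

lemma incl_single (S : Finset (Fin L)) (m : Fin L → ℕ) (z : ℂ) :
    incl S (Finsupp.single m z) = Finsupp.single ((S, m) : Config L) z := by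
  simp [incl]

lemma proj_single (S S' : Finset (Fin L)) (m : Fin L → ℕ) (z : ℂ) :
    proj S (Finsupp.single ((S', m) : Config L) z) =
      if S = S' then Finsupp.single m z else 0 := by
  classical
  ext m'
  simp only [proj, Finsupp.lcomapDomain, LinearMap.coe_mk, AddHom.coe_mk,
    Finsupp.comapDomain_apply, Finsupp.single_apply]
  by_cases h : S = S'
  · subst h
    simp [Finsupp.single_apply]
  · simp [h, Ne.symm h]

lemma sum_incl_proj (x : Fock L) : ∑ S, incl S (proj S x) = x := by
  classical
  induction x using Finsupp.induction_linear with
  | zero => simp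
  | add x y hx hy =>
    simp only [map_add, Finset.sum_add_distrib, hx, hy]
  | single s z =>
    obtain ⟨S, m⟩ := s
    rw [Finset.sum_eq_single S]
    · rw [proj_single, if_pos rfl, incl_single]
    · intro R _ hR
      rw [proj_single, if_neg hR, map_zero]
    · simp

/-- The block of an operator mapping the sector `S'` to the sector `S`. -/
noncomputable def entry (S S' : Finset (Fin L)) : Op L →ₗ[ℂ] PhononOp L where
  toFun A := proj S ∘ₗ A ∘ₗ incl S'
  map_add' A B := by
    refine LinearMap.ext fun x => ?_
    simp
  map_smul' z A := by
    refine LinearMap.ext fun x => ?_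
    simp

lemma entry_apply (A : Op L) (S S' : Finset (Fin L)) (x : PhononFock L) :
    entry S S' A x = proj S (A (incl S' x)) := rfl

lemma entry_apply_single (A : Op L) (S S' : Finset (Fin L)) (m : Fin L → ℕ) (z : ℂ) :
    entry S S' A (Finsupp.single m z) = proj S (A (Finsupp.single ((S', m) : Config L) z)) := by
  rw [entry_apply, incl_single]

lemma entry_mul (A B : Op L) (S S' : Finset (Fin L)) :
    entry S S' (A * B) = ∑ R, entry S R A * entry R S' B := by
  refine LinearMap.ext fun x => ?_
  rw [entry_apply, Module.End.mul_apply, LinearMap.sum_apply]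
  conv_lhs => rw [← sum_incl_proj (B (incl S' x)), map_sum, map_sum]
  rfl

lemma entry_ext {A B : Op L} (h : ∀ S S', entry S S' A = entry S S' B) : A = B := by
  apply op_ext
  intro S' m z
  rw [← sum_incl_proj (A _), ← sum_incl_proj (B _)]
  refine Finset.sum_congr rfl fun S _ => ?_
  rw [← entry_apply_single, ← entry_apply_single, h]

lemma entry_one (S S' : Finset (Fin L)) : entry S S' (1 : Op L) = if S = S' then 1 else 0 := by
  refine Finsupp.lhom_ext fun m z => ?_
  rw [entry_apply_single, Module.End.one_apply, proj_single]
  split_ifs <;> simp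

lemma entry_b (i : Fin L) (S S' : Finset (Fin L)) :
    entry S S' (b i) = if S = S' then low i else 0 := by
  refine Finsupp.lhom_ext fun m z => ?_
  rw [entry_apply_single, b_single, proj_single]
  split_ifs
  · rw [low_single]
  · rfl

lemma entry_bDag (i : Fin L) (S S' : Finset (Fin L)) :
    entry S S' (bDag i) = if S = S' then up i else 0 := by
  refine Finsupp.lhom_ext fun m z => ?_
  rw [entry_apply_single, bDag_single, proj_single]
  split_ifs
  · rw [up_single]
  · rfl

lemma entry_num (i : Fin L) (S S' : Finset (Fin L)) :
    entry S S' (num i) = if S = S' then (if i ∈ S' then 1 else 0) else 0 := by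
  refine Finsupp.lhom_ext fun m z => ?_
  rw [entry_apply_single, num_single]
  by_cases h : i ∈ S'
  · rw [if_pos h, proj_single, if_pos h]
    split_ifs <;> simp
  · simp [h]

/-- The matrix of `c i` on fermion configurations. -/
noncomputable def cMat (i : Fin L) (S S' : Finset (Fin L)) : ℂ :=
  if i ∈ S' ∧ S = S'.erase i then fermiSign S' i else 0

/-- The matrix of `cDag i` on fermion configurations. -/
noncomputable def cDagMat (i : Fin L) (S S' : Finset (Fin L)) : ℂ :=
  if i ∉ S' ∧ S = insert i S' then fermiSign S' i else 0

lemma entry_c (i : Fin L) (S S' : Finset (Fin L)) : entry S S' (c i) = cMat i S S' • 1 := by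
  refine Finsupp.lhom_ext fun m z => ?_
  rw [entry_apply_single, c_single, cMat, LinearMap.smul_apply, Module.End.one_apply]
  by_cases h : i ∈ S'
  · rw [if_pos h, proj_single]
    simp only [h, true_and]
    split_ifs <;> simp [mul_comm]
  · simp [h]

lemma entry_cDag (i : Fin L) (S S' : Finset (Fin L)) :
    entry S S' (cDag i) = cDagMat i S S' • 1 := by
  refine Finsupp.lhom_ext fun m z => ?_
  rw [entry_apply_single, cDag_single, cDagMat, LinearMap.smul_apply, Module.End.one_apply]
  by_cases h : i ∈ S'
  · simp [h]
  · rw [if_neg h, proj_single]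
    simp only [h, not_false_eq_true, true_and]
    split_ifs <;> simp [mul_comm]

lemma entry_diag_mul {A : Op L} {X : Finset (Fin L) → PhononOp L}
    (hA : ∀ S S', entry S S' A = if S = S' then X S' else 0) (B : Op L) (S S' : Finset (Fin L)) :
    entry S S' (A * B) = X S * entry S S' B := by
  rw [entry_mul, Finset.sum_eq_single S]
  · rw [hA, if_pos rfl]
  · intro R _ hR
    rw [hA, if_neg hR.symm, zero_mul]
  · simp

lemma entry_mul_diag {A : Op L} {X : Finset (Fin L) → PhononOp L}
    (hA : ∀ S S', entry S S' A = if S = S' then X S' else 0) (B : Op L) (S S' : Finset (Fin L)) :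
    entry S S' (B * A) = entry S S' B * X S' := by
  rw [entry_mul, Finset.sum_eq_single S']
  · rw [hA, if_pos rfl]
  · intro R _ hR
    rw [hA, if_neg hR, mul_zero]
  · simp

/-- The hopping matrix on fermion configurations. -/
noncomputable def hopMat (L : ℕ) [NeZero L] (t : ℝ) (S S' : Finset (Fin L)) : ℂ :=
  t * ∑ i : Fin L, (∑ R, cDagMat i S R * cMat (i + Fin.ofNat L 1) R S' +
    ∑ R, cDagMat (i + Fin.ofNat L 1) S R * cMat i R S')

lemma entry_cDag_mul_c (i j : Fin L) (S S' : Finset (Fin L)) :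
    entry S S' (cDag i * c j) = (∑ R, cDagMat i S R * cMat j R S') • 1 := by
  rw [entry_mul, Finset.sum_smul]
  refine Finset.sum_congr rfl fun R _ => ?_
  rw [entry_cDag, entry_c, smul_mul_smul_comm, one_mul]

lemma entry_hop [NeZero L] (t : ℝ) (S S' : Finset (Fin L)) :
    entry S S' (hop L t) = hopMat L t S S' • 1 := by
  rw [hop, map_smul, map_sum, hopMat, mul_smul, Finset.sum_smul]
  congr 1
  refine Finset.sum_congr rfl fun i _ => ?_
  rw [map_add, entry_cDag_mul_c, entry_cDag_mul_c, add_smul]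

lemma sum_cDagMat_mul_cMat (i j : Fin L) (S S' : Finset (Fin L)) :
    ∑ R, cDagMat i S R * cMat j R S' =
      if j ∈ S' ∧ i ∉ S'.erase j ∧ S = insert i (S'.erase j) then
        fermiSign (S'.erase j) i * fermiSign S' j else 0 := by
  rw [Finset.sum_eq_single (S'.erase j)]
  · simp only [cDagMat, cMat, and_true]
    split_ifs <;> simp_all
  · intro R _ hR
    rw [cMat, if_neg (fun h => hR h.2), mul_zero]
  · simp

lemma fermiSign_ne_zero (S : Finset (Fin L)) (i : Fin L) : fermiSign S i ≠ 0 := by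
  intro h
  have := fermiSign_mul_self S i
  rw [h, mul_zero] at this
  exact zero_ne_one this

lemma eq_of_exchange {R : Finset (Fin L)} {i j l m : Fin L}
    (hlm : l ≠ m) (hm : m ∈ insert j R) (hl : l ∉ (insert j R).erase m)
    (h : insert i R = insert l ((insert j R).erase m)) : l = i ∧ m = j := by
  have h1 : l = i := by
    have : l ∈ insert i R := by
      rw [h]
      exact Finset.mem_insert_self _ _
    rcases Finset.mem_insert.1 this with h2 | h2
    · exact h2
    · exact absurd (Finset.mem_erase.2 ⟨hlm, Finset.mem_insert_of_mem h2⟩) hl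
  refine ⟨h1, ?_⟩
  rcases Finset.mem_insert.1 hm with h2 | h2
  · exact h2
  · have : m ∈ insert l ((insert j R).erase m) := by
      rw [← h]
      exact Finset.mem_insert_of_mem h2
    rcases Finset.mem_insert.1 this with h3 | h3
    · exact absurd h3.symm hlm
    · exact absurd h3 (Finset.notMem_erase _ _)

/-- For L ≥ 3 the two configurations determine the bond and the direction of the hop, so exactly one
term of the sum is nonzero and nothing can cancel. -/
lemma hopMat_ne_zero [NeZero L] (hL : 3 ≤ L) {t : ℝ} (ht : t ≠ 0) (R : Finset (Fin L)) (i : Fin L)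
    (hi : i ∉ R) (hj : i + Fin.ofNat L 1 ∉ R) :
    hopMat L t (insert i R) (insert (i + Fin.ofNat L 1) R) ≠ 0 := by
  have hne : ∀ i : Fin L, i + Fin.ofNat L 1 ≠ i := fun i => add_ofNat_ne i le_rfl (by omega)
  have hne2 : i + Fin.ofNat L 1 + Fin.ofNat L 1 ≠ i := by
    rw [add_ofNat_add_ofNat]
    exact add_ofNat_ne i (by omega) (by omega)
  rw [hopMat, Finset.sum_eq_single i]
  · rw [sum_cDagMat_mul_cMat, sum_cDagMat_mul_cMat, if_pos, if_neg, add_zero]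
    · refine mul_ne_zero (by exact_mod_cast ht) (mul_ne_zero ?_ ?_) <;>
        exact fermiSign_ne_zero _ _
    · rintro ⟨h1, h2, h3⟩
      exact hne i (eq_of_exchange (hne i) h1 h2 h3).1
    · rw [Finset.erase_insert hj]
      exact ⟨Finset.mem_insert_self _ _, hi, rfl⟩
  · intro l _ hl
    rw [sum_cDagMat_mul_cMat, sum_cDagMat_mul_cMat, if_neg, if_neg, add_zero]
    · rintro ⟨h1, h2, h3⟩
      obtain ⟨h4, rfl⟩ := eq_of_exchange (hne l) h1 h2 h3
      exact hne2 h4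
    · rintro ⟨h1, h2, h3⟩
      exact hl (eq_of_exchange (hne l).symm h1 h2 h3).1
  · simp

/-- The part of the Hamiltonian preserving the fermion configuration. -/
noncomputable def diagHam (g ω μ : ℝ) (S : Finset (Fin L)) : PhononOp L :=
  (g : ℂ) • ∑ i ∈ S, (up i + low i) + (ω : ℂ) • ∑ i, up i * low i + ((μ : ℂ) * S.card) • 1

lemma entry_hamiltonian [NeZero L] (t g ω μ : ℝ) (S S' : Finset (Fin L)) :
    entry S S' (hamiltonian L t g ω μ) =
      hopMat L t S S' • 1 + if S = S' then diagHam g ω μ S' else 0 := by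
  have hint : entry S S' (interaction L g) =
      if S = S' then (g : ℂ) • ∑ i ∈ S', (up i + low i) else 0 := by
    rw [interaction, map_smul, map_sum]
    simp only [entry_diag_mul (entry_num _), map_add, entry_b, entry_bDag]
    split_ifs with h
    · subst h
      simp
    · simp
  have hph : entry S S' (phonon L ω) =
      if S = S' then (ω : ℂ) • ∑ i, up i * low i else 0 := by
    rw [phonon, map_smul, map_sum]
    simp only [entry_diag_mul (X := fun _ => up _) (entry_bDag _), entry_b]
    split_ifs <;> simp
  have hch : entry S S' (chem L μ) =
      if S = S' then ((μ : ℂ) * S'.card) • 1 else 0 := by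
    rw [chem, map_smul, map_sum]
    simp only [entry_num]
    split_ifs
    · rw [mul_smul, Finset.sum_ite_mem, Finset.univ_inter, Finset.sum_const,
        Nat.cast_smul_eq_nsmul]
    · simp
  rw [hamiltonian, map_add, map_add, map_add, entry_hop, hint, hph, hch, diagHam]
  split_ifs
  · simp only [add_assoc]
  · simp

/-- `F` consists of the normal-ordered symbols of the blocks of `Q`. -/
def IsSymbol (Q : Op L) (F : Finset (Fin L) → Finset (Fin L) → Sym L) : Prop :=
  ∀ S S', entry S S' Q = quant (F S S')

lemma quant_mul_field (p : Sym L) (S : Finset (Fin L)) :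
    quant p * ∑ i ∈ S, (up i + low i) =
      quant (field S * p + ∑ i ∈ S, pderiv (.inr i) p) := by
  rw [Finset.mul_sum, field, Finset.sum_mul, ← Finset.sum_add_distrib, map_sum]
  refine Finset.sum_congr rfl fun i _ => ?_
  rw [mul_add, quant_mul_up, ← quant_inr_mul, ← map_add]
  congr 1
  ring

lemma field_mul_quant (p : Sym L) (S : Finset (Fin L)) :
    (∑ i ∈ S, (up i + low i)) * quant p =
      quant (field S * p + ∑ i ∈ S, pderiv (.inl i) p) := by
  rw [Finset.sum_mul, field, Finset.sum_mul, ← Finset.sum_add_distrib, map_sum]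
  refine Finset.sum_congr rfl fun i _ => ?_
  rw [add_mul, low_mul_quant, ← quant_inl_mul, ← map_add]
  congr 1
  ring

lemma quant_charge (p : Sym L) :
    quant (charge p) = quant p * (∑ i, up i * low i) - (∑ i, up i * low i) * quant p := by
  rw [charge_apply, Finset.mul_sum, Finset.sum_mul, ← Finset.sum_sub_distrib, map_sum]
  refine Finset.sum_congr rfl fun i _ => ?_
  rw [← mul_assoc, quant_mul_up, mul_assoc, low_mul_quant, ← quant_inl_mul, ← quant_inr_mul,
    ← map_sub]
  congr 1
  ring

theorem quant_symComm [NeZero L] {t g ω μ : ℝ} {Q : Op L}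
    {F : Finset (Fin L) → Finset (Fin L) → Sym L} (hQ : IsSymbol Q F) (S S' : Finset (Fin L)) :
    quant (symComm g ω μ (hopMat L t) F S S') =
      entry S S' (Q * hamiltonian L t g ω μ - hamiltonian L t g ω μ * Q) := by
  have h1 : entry S S' (Q * hamiltonian L t g ω μ) =
      (∑ R, hopMat L t R S' • quant (F S R)) + quant (F S S') * diagHam g ω μ S' := by
    rw [entry_mul]
    simp only [hQ _ _, entry_hamiltonian, mul_add, Finset.sum_add_distrib, mul_ite, mul_zero,
      Finset.sum_ite_eq', Finset.mem_univ, if_true, mul_smul_comm, mul_one]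
  have h2 : entry S S' (hamiltonian L t g ω μ * Q) =
      (∑ R, hopMat L t S R • quant (F R S')) + diagHam g ω μ S * quant (F S S') := by
    rw [entry_mul]
    simp only [hQ _ _, entry_hamiltonian, add_mul, Finset.sum_add_distrib, ite_mul, zero_mul,
      Finset.sum_ite_eq, Finset.mem_univ, if_true, smul_mul_assoc, one_mul]
  rw [map_sub, h1, h2, diagHam, diagHam]
  simp only [mul_add, add_mul, mul_smul_comm, smul_mul_assoc, quant_mul_field, field_mul_quant,
    mul_one, one_mul]
  have h3 := quant_charge (F S S')
  have h4 : quant (F S S') * (∑ i, up i * low i) =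
    quant (charge (F S S')) + (∑ i, up i * low i) * quant (F S S') := by rw [h3, sub_add_cancel]
  rw [h4]
  simp only [symComm, map_add, map_sub, map_sum, C_mul', map_smul, sub_mul, smul_add,
    Finset.sum_sub_distrib, mul_sub]
  abel

/-! ### Locality: constraints on the symbols of short-block operators. -/

/-- The parity of the number of fermions on sites satisfying `P`. -/
noncomputable def paritySign (P : Fin L → Prop) [DecidablePred P] (S : Finset (Fin L)) : ℂ :=
  (-1) ^ (S.filter P).card

lemma symmDiff_singleton_of_mem {S : Finset (Fin L)} {a : Fin L} (h : a ∈ S) :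
    S ∆ {a} = S.erase a := by
  ext x
  simp only [Finset.mem_symmDiff, Finset.mem_singleton, Finset.mem_erase]
  by_cases hx : x = a <;> simp_all

lemma symmDiff_singleton_of_notMem {S : Finset (Fin L)} {a : Fin L} (h : a ∉ S) :
    S ∆ {a} = insert a S := by
  ext x
  simp only [Finset.mem_symmDiff, Finset.mem_singleton, Finset.mem_insert]
  by_cases hx : x = a <;> simp_all

lemma paritySign_insert (P : Fin L → Prop) [DecidablePred P] {S : Finset (Fin L)} {a : Fin L}
    (h : a ∉ S) : paritySign P (insert a S) = (if P a then -1 else 1) * paritySign P S := by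
  rw [paritySign, paritySign, Finset.filter_insert]
  split_ifs with hP
  · rw [Finset.card_insert_of_notMem (by simp [h]), pow_succ, mul_comm]
  · rw [one_mul]

lemma paritySign_symmDiff (P : Fin L → Prop) [DecidablePred P] (S : Finset (Fin L)) (a : Fin L) :
    paritySign P (S ∆ {a}) = (if P a then -1 else 1) * paritySign P S := by
  by_cases h : a ∈ S
  · rw [symmDiff_singleton_of_mem h]
    conv_rhs => rw [← Finset.insert_erase h, paritySign_insert P (Finset.notMem_erase a S)]
    split_ifs <;> ring
  · rw [symmDiff_singleton_of_notMem h, paritySign_insert P h]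

lemma paritySign_ne_zero (P : Fin L → Prop) [DecidablePred P] (S : Finset (Fin L)) :
    paritySign P S ≠ 0 := pow_ne_zero _ (by norm_num)

lemma fermiSign_eq (S : Finset (Fin L)) (i : Fin L) : fermiSign S i = paritySign (· < i) S := rfl

/-- The operator flipping the occupation of the site `a`, with the sign that makes it commute with
the fermion operators of all other sites. -/
noncomputable def flipOp (a : Fin L) : Op L :=
  Finsupp.linearCombination ℂ (fun s : Config L =>
    Finsupp.single ((s.1 ∆ {a}, s.2) : Config L) (paritySign (a < ·) s.1))

lemma flipOp_single (a : Fin L) (S : Finset (Fin L)) (m : Fin L → ℕ) (z : ℂ) :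
    flipOp a (Finsupp.single ((S, m) : Config L) z) =
      Finsupp.single ((S ∆ {a}, m) : Config L) (z * paritySign (a < ·) S) := by
  rw [flipOp, Finsupp.linearCombination_single]
  simp

lemma c_single_symmDiff (i : Fin L) (S : Finset (Fin L)) (m : Fin L → ℕ) (z : ℂ) :
    c i (Finsupp.single ((S, m) : Config L) z) =
      if i ∈ S then Finsupp.single ((S ∆ {i}, m) : Config L) (z * fermiSign S i) else 0 := by
  rw [c_single]
  split_ifs with h
  · rw [symmDiff_singleton_of_mem h]
  · rfl

lemma cDag_single_symmDiff (i : Fin L) (S : Finset (Fin L)) (m : Fin L → ℕ) (z : ℂ) :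
    cDag i (Finsupp.single ((S, m) : Config L) z) =
      if i ∈ S then 0 else Finsupp.single ((S ∆ {i}, m) : Config L) (z * fermiSign S i) := by
  rw [cDag_single]
  split_ifs with h
  · rfl
  · rw [symmDiff_singleton_of_notMem h]

lemma mem_symmDiff_singleton {S : Finset (Fin L)} {a j : Fin L} (h : j ≠ a) :
    j ∈ S ∆ {a} ↔ j ∈ S := by
  simp [Finset.mem_symmDiff, h]

/-- Flipping a changes the sign of the fermion operator at j exactly when a < j, and flipping j
changes the parity to the right of a in exactly the same case. -/
lemma sign_exchange (S : Finset (Fin L)) (a j : Fin L) (z : ℂ) :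
    z * fermiSign S j * paritySign (a < ·) (S ∆ {j}) =
      z * paritySign (a < ·) S * fermiSign (S ∆ {a}) j := by
  rw [fermiSign_eq, fermiSign_eq, paritySign_symmDiff, paritySign_symmDiff]
  ring

lemma c_commute_flipOp {a j : Fin L} (h : j ≠ a) : c j * flipOp a = flipOp a * c j := by
  refine op_ext fun S m z => ?_
  simp only [Module.End.mul_apply, flipOp_single, c_single_symmDiff, mem_symmDiff_singleton h]
  split_ifs
  · rw [flipOp_single, sign_exchange, symmDiff_right_comm]
  · rw [map_zero]

lemma cDag_commute_flipOp {a j : Fin L} (h : j ≠ a) :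
    cDag j * flipOp a = flipOp a * cDag j := by
  refine op_ext fun S m z => ?_
  simp only [Module.End.mul_apply, flipOp_single, cDag_single_symmDiff, mem_symmDiff_singleton h]
  split_ifs
  · rw [map_zero]
  · rw [flipOp_single, sign_exchange, symmDiff_right_comm]

lemma b_commute_flipOp (a j : Fin L) : b j * flipOp a = flipOp a * b j := by
  refine op_ext fun S m z => ?_
  simp only [Module.End.mul_apply, flipOp_single, b_single]
  congr 1
  ring

lemma bDag_commute_flipOp (a j : Fin L) : bDag j * flipOp a = flipOp a * bDag j := by
  refine op_ext fun S m z => ?_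
  simp only [Module.End.mul_apply, flipOp_single, bDag_single]
  congr 1
  ring

lemma c_commute_b (i j : Fin L) : c i * b j = b j * c i := by
  refine entry_ext fun S S' => ?_
  rw [entry_diag_mul (X := fun _ => low j) (entry_b j),
    entry_mul_diag (X := fun _ => low j) (entry_b j), entry_c]
  simp

lemma cDag_commute_b (i j : Fin L) : cDag i * b j = b j * cDag i := by
  refine entry_ext fun S S' => ?_
  rw [entry_diag_mul (X := fun _ => low j) (entry_b j),
    entry_mul_diag (X := fun _ => low j) (entry_b j), entry_cDag]
  simp

lemma c_commute_bDag (i j : Fin L) : c i * bDag j = bDag j * c i := by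
  refine entry_ext fun S S' => ?_
  rw [entry_diag_mul (X := fun _ => up j) (entry_bDag j),
    entry_mul_diag (X := fun _ => up j) (entry_bDag j), entry_c]
  simp

lemma cDag_commute_bDag (i j : Fin L) : cDag i * bDag j = bDag j * cDag i := by
  refine entry_ext fun S S' => ?_
  rw [entry_diag_mul (X := fun _ => up j) (entry_bDag j),
    entry_mul_diag (X := fun _ => up j) (entry_bDag j), entry_cDag]
  simp

lemma b_commute_b (i j : Fin L) : b i * b j = b j * b i := by
  refine entry_ext fun S S' => ?_
  rw [entry_diag_mul (X := fun _ => low j) (entry_b j),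
    entry_mul_diag (X := fun _ => low j) (entry_b j), entry_b]
  split_ifs
  · exact low_mul_low i j
  · simp

lemma bDag_commute_bDag (i j : Fin L) : bDag i * bDag j = bDag j * bDag i := by
  refine entry_ext fun S S' => ?_
  rw [entry_diag_mul (X := fun _ => up j) (entry_bDag j),
    entry_mul_diag (X := fun _ => up j) (entry_bDag j), entry_bDag]
  split_ifs
  · exact up_mul_up i j
  · simp

lemma b_commute_bDag {i j : Fin L} (h : i ≠ j) : b i * bDag j = bDag j * b i := by
  refine entry_ext fun S S' => ?_
  rw [entry_diag_mul (X := fun _ => up j) (entry_bDag j),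
    entry_mul_diag (X := fun _ => up j) (entry_bDag j), entry_b]
  split_ifs
  · exact low_mul_up_of_ne h
  · simp

lemma commute_of_mem_localAlgebra {I : Set (Fin L)} {A B : Op L} (hA : A ∈ localAlgebra I)
    (h : ∀ j ∈ I, c j * B = B * c j ∧ cDag j * B = B * cDag j ∧ b j * B = B * b j ∧
      bDag j * B = B * bDag j) : A * B = B * A := by
  have : localAlgebra I ≤ Subalgebra.centralizer ℂ {B} := by
    apply Algebra.adjoin_le
    rintro X ⟨j, hj, hX⟩
    rw [SetLike.mem_coe, Subalgebra.mem_centralizer_iff]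
    rintro _ rfl
    obtain ⟨h1, h2, h3, h4⟩ := h j hj
    rcases hX with rfl | rfl | rfl | rfl
    · exact h1.symm
    · exact h2.symm
    · exact h3.symm
    · exact h4.symm
  exact ((Subalgebra.mem_centralizer_iff ℂ).1 (this hA) B rfl).symm

lemma proj_flipOp (a : Fin L) (S : Finset (Fin L)) (x : Fock L) :
    proj (S ∆ {a}) (flipOp a x) = paritySign (a < ·) S • proj S x := by
  induction x using Finsupp.induction_linear with
  | zero => simp
  | add x y hx hy => rw [map_add, map_add, hx, hy, map_add, smul_add]
  | single s z =>
    obtain ⟨S', m⟩ := s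
    rw [flipOp_single, proj_single, proj_single]
    by_cases h : S = S'
    · subst h
      simp [mul_comm]
    · rw [if_neg h, if_neg (fun h' => h (symmDiff_left_injective _ h')), smul_zero]

/-- A commutes with `flipOp a`, which carries one sector onto the other; the nonzero parity sign
occurs on both sides and cancels. -/
lemma entry_flip {I : Set (Fin L)} {A : Op L} (hA : A ∈ localAlgebra I) {a : Fin L} (ha : a ∉ I)
    (S : Finset (Fin L)) : entry (S ∆ {a}) (S ∆ {a}) A = entry S S A := by
  have h := commute_of_mem_localAlgebra (B := flipOp a) hA fun j hj =>
    have hja : j ≠ a := fun h => ha (h ▸ hj)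
    ⟨c_commute_flipOp hja, cDag_commute_flipOp hja, b_commute_flipOp a j, bDag_commute_flipOp a j⟩
  refine Finsupp.lhom_ext fun m z => ?_
  have h1 := congrArg (fun B : Op L => proj (S ∆ {a}) (B (Finsupp.single ((S, m) : Config L) z))) h
  simp only [Module.End.mul_apply, proj_flipOp, flipOp_single] at h1
  rw [← entry_apply_single, ← entry_apply_single, mul_comm, ← smul_eq_mul, ← Finsupp.smul_single,
    map_smul] at h1
  exact smul_right_injective _ (paritySign_ne_zero _ _) h1

/-- A commutes with b_a and b†_a, and the commutators with these are the quantized derivatives. -/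
lemma pderiv_symbol_eq_zero {I : Set (Fin L)} {A : Op L} (hA : A ∈ localAlgebra I)
    {F : Finset (Fin L) → Finset (Fin L) → Sym L} (hF : IsSymbol A F) {a : Fin L} (ha : a ∉ I)
    (S S' : Finset (Fin L)) {v : Fin L ⊕ Fin L} (hv : Sum.elim id id v = a) :
    pderiv v (F S S') = 0 := by
  apply quant_injective
  rw [map_zero]
  rcases v with j | j <;> obtain rfl : j = a := hv
  · rw [quant_pderiv_inl, ← hF, sub_eq_zero]
    have h := commute_of_mem_localAlgebra (B := b j) hA fun i _ =>
      ⟨c_commute_b i j, cDag_commute_b i j, b_commute_b i j,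
        (b_commute_bDag (i := j) (j := i) (by rintro rfl; contradiction)).symm⟩
    have h1 := congrArg (entry S S') h
    rw [entry_diag_mul (X := fun _ => low j) (entry_b j),
      entry_mul_diag (X := fun _ => low j) (entry_b j)] at h1
    exact h1.symm
  · rw [quant_pderiv_inr, ← hF, sub_eq_zero]
    have h := commute_of_mem_localAlgebra (B := bDag j) hA fun i _ =>
      ⟨c_commute_bDag i j, cDag_commute_bDag i j,
        b_commute_bDag (by rintro rfl; contradiction), bDag_commute_bDag i j⟩
    have h1 := congrArg (entry S S') h
    rwa [entry_diag_mul (X := fun _ => up j) (entry_bDag j),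
      entry_mul_diag (X := fun _ => up j) (entry_bDag j)] at h1

lemma exists_isSymbol {I : Set (Fin L)} {A : Op L} (hA : A ∈ localAlgebra I) :
    ∃ F, IsSymbol A F := by
  have hC : ∀ z : ℂ, (z • 1 : PhononOp L) ∈ LinearMap.range (quant (L := L)) :=
    fun z => ⟨C z, quant_C z⟩
  have hup : ∀ j, up j ∈ LinearMap.range (quant (L := L)) := fun j =>
    ⟨X (.inl j) * C 1, by rw [quant_inl_mul, quant_C, one_smul, mul_one]⟩
  have hlow : ∀ j, low j ∈ LinearMap.range (quant (L := L)) := fun j =>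
    ⟨X (.inr j) * C 1, by rw [quant_inr_mul, quant_C, one_smul, one_mul]⟩
  have key : ∀ S S', entry S S' A ∈ LinearMap.range (quant (L := L)) := by
    induction hA using Algebra.adjoin_induction with
    | mem X hX =>
      obtain ⟨j, -, hX⟩ := hX
      intro S S'
      rcases hX with rfl | rfl | rfl | rfl
      · rw [entry_c]
        exact hC _
      · rw [entry_cDag]
        exact hC _
      · rw [entry_b]
        split_ifs
        · exact hlow j
        · exact Submodule.zero_mem _
      · rw [entry_bDag]
        split_ifs
        · exact hup j
        · exact Submodule.zero_mem _
    | algebraMap z =>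
      intro S S'
      rw [Algebra.algebraMap_eq_smul_one, map_smul, entry_one]
      refine Submodule.smul_mem _ _ ?_
      split_ifs
      · simpa using hC 1
      · exact Submodule.zero_mem _
    | add A B _ _ hA hB =>
      intro S S'
      rw [map_add]
      exact Submodule.add_mem _ (hA S S') (hB S S')
    | mul A B _ _ hA hB =>
      intro S S'
      rw [entry_mul]
      refine Submodule.sum_mem _ fun R _ => ?_
      obtain ⟨p, hp⟩ := hA S R
      rw [← hp]
      exact quant_mul_mem_range p _ (hB R S')
  choose F hF using key
  exact ⟨F, fun S S' => (hF S S').symm⟩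

/-- Otherwise offsets j, j' < k satisfy j + L/2 ≡ j' modulo L. Both sides are below L, hence equal,
yet j + L/2 ≥ k > j'. -/
lemma notMem_block_or [NeZero L] {k : ℕ} (hk : 2 * k ≤ L) (i a : Fin L) :
    a ∉ block i k ∨ a + Fin.ofNat L (L / 2) ∉ block i k := by
  by_contra! h
  obtain ⟨⟨j, hj, rfl⟩, j', hj', h'⟩ := h
  rw [add_ofNat_add_ofNat] at h'
  have := add_ofNat_inj i (by omega) (by omega) h'
  omega

/-- One of the two sites lies outside the block, so the symbol does not involve its phonons and the
diagonal blocks ignore its occupation; each constraint holds in either case. Being linear, the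
constraints then pass to sums of such operators. -/
lemma exists_isSymbol_of_isSupport [NeZero L] {k : ℕ} (hk : 2 * k ≤ L) {A : Op L}
    (hA : IsSupport k A) : ∃ F, IsSymbol A F ∧ FarConstraints (L / 2) F := by
  obtain ⟨i, hA⟩ := hA
  obtain ⟨F, hF⟩ := exists_isSymbol hA
  have hflip : ∀ a, a ∉ block i k → ∀ S, F (S ∆ {a}) (S ∆ {a}) = F S S := by
    intro a ha S
    apply quant_injective
    rw [← hF, ← hF, entry_flip hA ha]
  refine ⟨F, hF, ⟨?_, ?_, ?_⟩⟩
  · intro S S' a v w hv hw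
    rcases notMem_block_or hk i a with h | h
    · rw [pderiv_comm, pderiv_symbol_eq_zero hA hF h S S' hv, map_zero]
    · rw [pderiv_symbol_eq_zero hA hF h S S' hw, map_zero]
  · intro S a v hv
    rcases notMem_block_or hk i a with h | h
    · rw [map_sub, pderiv_symbol_eq_zero hA hF h _ _ hv, pderiv_symbol_eq_zero hA hF h _ _ hv,
        sub_zero]
    · rw [hflip _ h, sub_self, map_zero]
  · intro S a
    rcases notMem_block_or hk i a with h | h
    · rw [symmDiff_right_comm, hflip _ h, hflip _ h]
      ring
    · rw [hflip _ h, hflip _ h]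
      ring

lemma FarConstraints.add [NeZero L] {h : ℕ} {F G : Finset (Fin L) → Finset (Fin L) → Sym L}
    (hF : FarConstraints h F) (hG : FarConstraints h G) :
    FarConstraints h (fun S S' => F S S' + G S S') := by
  refine ⟨fun S S' i v w hv hw => ?_, fun S i v hv => ?_, fun S i => ?_⟩
  · rw [map_add, map_add, hF.mixed S S' i v w hv hw, hG.mixed S S' i v w hv hw, add_zero]
  · rw [add_sub_add_comm, map_add, hF.flip S i v hv, hG.flip S i v hv, add_zero]
  · linear_combination hF.flip_flip S i + hG.flip_flip S i

lemma FarConstraints.smul [NeZero L] {h : ℕ} {F : Finset (Fin L) → Finset (Fin L) → Sym L}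
    (hF : FarConstraints h F) (z : ℂ) : FarConstraints h (fun S S' => C z * F S S') := by
  refine ⟨fun S S' i v w hv hw => ?_, fun S i v hv => ?_, fun S i => ?_⟩
  · rw [pderiv_C_mul, pderiv_C_mul, hF.mixed S S' i v w hv hw, mul_zero]
  · rw [← mul_sub, pderiv_C_mul, hF.flip S i v hv, mul_zero]
  · linear_combination C z * hF.flip_flip S i

theorem exists_isSymbol_of_mem_supportSpan [NeZero L] {k : ℕ} (hk : 2 * k ≤ L) {Q : Op L}
    (hQ : Q ∈ supportSpan L k) : ∃ F, IsSymbol Q F ∧ FarConstraints (L / 2) F := by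
  induction hQ using Submodule.span_induction with
  | mem A hA => exact exists_isSymbol_of_isSupport hk hA
  | zero =>
    refine ⟨fun _ _ => 0, fun S S' => by rw [map_zero, map_zero], ⟨?_, ?_, ?_⟩⟩
    · intro S S' i v w _ _
      rw [map_zero, map_zero]
    · intro S i v _
      rw [sub_zero, map_zero]
    · intro S i
      ring
  | add A B _ _ hA hB =>
    obtain ⟨F, hF, hF'⟩ := hA
    obtain ⟨G, hG, hG'⟩ := hB
    exact ⟨_, fun S S' => by rw [map_add, map_add, hF, hG], hF'.add hG'⟩
  | smul z A _ hA =>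
    obtain ⟨F, hF, hF'⟩ := hA
    exact ⟨_, fun S S' => by rw [C_mul', map_smul, map_smul, hF], hF'.smul z⟩

theorem exists_constraints [NeZero L] {k : ℕ} (hk : 2 * k ≤ L) {t g ω μ : ℝ} {Q : Op L}
    (hQ : Q ∈ supportSpan L k)
    (hcomm : Q * hamiltonian L t g ω μ - hamiltonian L t g ω μ * Q = 0) :
    ∃ F, IsSymbol Q F ∧ Constraints g ω μ (hopMat L t) (L / 2) F := by
  obtain ⟨F, hF, hF'⟩ := exists_isSymbol_of_mem_supportSpan hk hQ
  refine ⟨F, hF, hF', fun S S' => ?_⟩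
  apply quant_injective
  rw [quant_symComm hF, hcomm, map_zero, map_zero]

/-! ### Degrees of symbols and the symbol of the Hamiltonian. -/

section Symbols

lemma comp_eq_zero_of_neg {n : ℤ} (hn : n < 0) (p : Sym L) : comp n p = 0 := by
  classical
  ext e
  rw [coeff_weightedHomogeneousComponent, coeff_zero, if_neg]
  intro h
  have : (0 : ℤ) ≤ Finsupp.weight (fun _ : Fin L ⊕ Fin L => (1 : ℤ)) e := by
    rw [Finsupp.weight_eq_sum]
    exact Finset.sum_nonneg fun i _ => by simp
  omega

lemma eq_C_of_comp_eq_zero {p : Sym L} (h : ∀ n, 0 < n → comp n p = 0) : p = C (coeff 0 p) := by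
  apply eq_C_of_pderiv_eq_zero
  intro v
  apply eq_zero_of_whc (fun _ => (1 : ℤ))
  intro n
  rw [comp_pderiv]
  by_cases hn : 0 < n + 1
  · rw [h _ hn, map_zero]
  · rcases (by omega : n + 1 < 0 ∨ n + 1 = 0) with h' | h'
    · rw [comp_eq_zero_of_neg h', map_zero]
    · rw [← comp_pderiv, comp_eq_zero_of_neg (by omega)]

lemma exists_comp_eq_zero (F : Finset (Fin L) → Finset (Fin L) → Sym L) :
    ∃ N : ℕ, ∀ n : ℤ, N < n → ∀ S S', comp n (F S S') = 0 := by
  choose N hN using fun S S' => whc_bounded (fun _ => (1 : ℤ)) (F S S')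
  refine ⟨∑ S, ∑ S', N S S', fun n hn S S' => hN S S' n ?_⟩
  have h1 : N S S' ≤ ∑ S', N S S' :=
    Finset.single_le_sum (f := fun S' => N S S') (fun _ _ => Nat.zero_le _) (Finset.mem_univ S')
  have h2 : ∑ S', N S S' ≤ ∑ S, ∑ S', N S S' :=
    Finset.single_le_sum (f := fun S => ∑ S', N S S') (fun _ _ => Nat.zero_le _)
      (Finset.mem_univ S)
  have h3 := le_abs_self n
  have h4 : ((N S S' : ℕ) : ℤ) ≤ ((∑ S, ∑ S', N S S' : ℕ) : ℤ) := by exact_mod_cast h1.trans h2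
  omega

/-- The symbol of the Hamiltonian. -/
noncomputable def hamSymbol [NeZero L] (t g ω μ : ℝ) (S S' : Finset (Fin L)) : Sym L :=
  C (hopMat L t S S') +
    if S = S' then C (g : ℂ) * (field S' * C 1) + C (ω : ℂ) * numberSymbol (Fin L) +
      C ((μ : ℂ) * S'.card) else 0

lemma isSymbol_hamiltonian [NeZero L] (t g ω μ : ℝ) :
    IsSymbol (hamiltonian L t g ω μ) (hamSymbol t g ω μ) := by
  intro S S'
  have h1 : quant (field S' * C 1) = ∑ i ∈ S', (up i + low i) := by
    have := quant_mul_field (C 1) S'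
    simp only [pderiv_C, Finset.sum_const_zero, add_zero] at this
    rw [← this, quant_C, one_smul, one_mul]
  have h2 : quant (numberSymbol (Fin L)) = ∑ i, up i * low i := by
    rw [numberSymbol, map_sum]
    refine Finset.sum_congr rfl fun i _ => ?_
    rw [quant_inl_mul, ← mul_one (X _), ← C_1, quant_inr_mul, quant_C, one_smul, one_mul]
  rw [entry_hamiltonian, hamSymbol, map_add, quant_C, diagHam]
  split_ifs
  · rw [map_add, map_add, C_mul', map_smul, h1, C_mul', map_smul, h2, quant_C]
  · rw [map_zero]

lemma comp_hamSymbol [NeZero L] (t g ω μ : ℝ) {n : ℤ} (hn : 1 < n) (S S' : Finset (Fin L)) :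
    comp n (hamSymbol t g ω μ S S') =
      if S = S' ∧ n = 2 then C (ω : ℂ) * numberSymbol (Fin L) else 0 := by
  rw [hamSymbol, map_add, comp_C, if_neg (by omega), zero_add]
  by_cases hS : S = S'
  · simp only [hS, if_true, true_and]
    rw [map_add, map_add, weightedHomogeneousComponent_C_mul, weightedHomogeneousComponent_C_mul,
      comp_field_mul, comp_C, comp_C, comp_numberSymbol, if_neg (by omega : ¬ n - 1 = 0),
      if_neg (by omega : ¬ n = 0)]
    split_ifs <;> simp
  · simp [hS]

end Symbols

/-! ### Membership in the spans of short-support operators. -/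

section Support

lemma c_mem {I : Set (Fin L)} {j : Fin L} (hj : j ∈ I) : c j ∈ localAlgebra I :=
  Algebra.subset_adjoin ⟨j, hj, by simp⟩

lemma cDag_mem {I : Set (Fin L)} {j : Fin L} (hj : j ∈ I) : cDag j ∈ localAlgebra I :=
  Algebra.subset_adjoin ⟨j, hj, by simp⟩

lemma b_mem {I : Set (Fin L)} {j : Fin L} (hj : j ∈ I) : b j ∈ localAlgebra I :=
  Algebra.subset_adjoin ⟨j, hj, by simp⟩

lemma bDag_mem {I : Set (Fin L)} {j : Fin L} (hj : j ∈ I) : bDag j ∈ localAlgebra I :=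
  Algebra.subset_adjoin ⟨j, hj, by simp⟩

lemma num_mem {I : Set (Fin L)} {j : Fin L} (hj : j ∈ I) : num j ∈ localAlgebra I :=
  mul_mem (cDag_mem hj) (c_mem hj)

variable [NeZero L]

lemma mem_block (i : Fin L) {j k : ℕ} (hj : j < k) : i + Fin.ofNat L j ∈ block i k :=
  ⟨j, hj, rfl⟩

lemma self_mem_block (i : Fin L) {k : ℕ} (hk : 1 ≤ k) : i ∈ block i k := by
  have := mem_block i (show 0 < k from hk)
  rwa [add_ofNat_zero] at this

lemma one_mem_supportSpan (k : ℕ) : (1 : Op L) ∈ supportSpan L k :=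
  Submodule.subset_span ⟨0, one_mem _⟩

lemma sum_num_mem_supportSpan {k : ℕ} (hk : 1 ≤ k) :
    ∑ i : Fin L, num i ∈ supportSpan L k :=
  Submodule.sum_mem _ fun i _ => Submodule.subset_span ⟨i, num_mem (self_mem_block i hk)⟩

lemma hamiltonian_mem_supportSpan (t g ω μ : ℝ) {k : ℕ} (hk : 2 ≤ k) :
    hamiltonian L t g ω μ ∈ supportSpan L k := by
  have h0 : ∀ i : Fin L, i ∈ block i k := fun i => self_mem_block i (by omega)
  have h1 : ∀ i : Fin L, i + Fin.ofNat L 1 ∈ block i k := fun i => mem_block i (by omega)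
  refine add_mem (add_mem (add_mem ?_ ?_) ?_) ?_ <;>
    refine Submodule.smul_mem _ _ (Submodule.sum_mem _ fun i _ =>
      Submodule.subset_span ⟨i, ?_⟩)
  · exact add_mem (mul_mem (cDag_mem (h0 i)) (c_mem (h1 i)))
      (mul_mem (cDag_mem (h1 i)) (c_mem (h0 i)))
  · exact mul_mem (num_mem (h0 i)) (add_mem (bDag_mem (h0 i)) (b_mem (h0 i)))
  · exact mul_mem (bDag_mem (h0 i)) (b_mem (h0 i))
  · exact num_mem (h0 i)

end Support

/-! ### Conclusion: only 1, the fermion number and H remain. -/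

section Main

variable [NeZero L]

/-- With particles added at 0 and at h, the vanishing second difference becomes the recursion a(n+2)
= 2a(n+1) − a(n) in the particle number. -/
lemma affine_of_second_difference {h : ℕ} (h0 : 0 < h) (hL : h < L) {a : Finset (Fin L) → ℂ}
    (hcard : ∀ S S', S.card = S'.card → a S = a S')
    (ha : ∀ S i, a (S ∆ {i} ∆ {i + Fin.ofNat L h}) - a (S ∆ {i}) -
      a (S ∆ {i + Fin.ofNat L h}) + a S = 0) (S : Finset (Fin L)) :
    a S = a ∅ + (a {0} - a ∅) * S.card := by
  induction hn : S.card using Nat.strong_induction_on generalizing S with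
  | _ n ih =>
    match n, hn with
    | 0, hn =>
      rw [Finset.card_eq_zero.1 hn]
      simp
    | 1, hn =>
      rw [hcard S {0} (by simpa using hn)]
      simp
    | n + 2, hn =>
      have hne : (0 : Fin L) + Fin.ofNat L h ≠ 0 := add_ofNat_ne 0 h0 hL
      set i : Fin L := 0
      set j : Fin L := i + Fin.ofNat L h with hj
      have hle := Finset.card_le_univ S
      rw [Fintype.card_fin] at hle
      obtain ⟨S0, hS0, hc⟩ := Finset.exists_subset_card_eq
        (s := (Finset.univ.erase i).erase j) (n := n) (by
          rw [Finset.card_erase_of_mem (by simpa using hne), Finset.card_erase_of_mem (by simp),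
            Finset.card_univ, Fintype.card_fin]
          omega)
      have hi0 : i ∉ S0 := fun h => by simpa using hS0 h
      have hj0 : j ∉ S0 := fun h => by simpa using hS0 h
      have hji : j ∉ insert i S0 := by
        rw [Finset.mem_insert, not_or]
        exact ⟨hne, hj0⟩
      have := ha S0 i
      rw [← hj, symmDiff_singleton_of_notMem hi0, symmDiff_singleton_of_notMem hj0,
        symmDiff_singleton_of_notMem hji] at this
      have c1 : (insert i S0).card = n + 1 := by rw [Finset.card_insert_of_notMem hi0, hc]
      have c2 : (insert j S0).card = n + 1 := by rw [Finset.card_insert_of_notMem hj0, hc]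
      have c3 : (insert j (insert i S0)).card = n + 2 := by
        rw [Finset.card_insert_of_notMem hji, c1]
      rw [hcard _ S (c3.trans hn.symm), ih (n + 1) (by omega) _ c1, ih (n + 1) (by omega) _ c2,
        ih n (by omega) _ hc] at this
      push_cast at this ⊢
      linear_combination this

/-- A conserved quantity of symbol degree at most zero is affine in the fermion number. -/
lemma mem_supportSpan_of_comp_eq_zero {t g ω μ : ℝ} (ht : t ≠ 0) (hg : g ≠ 0) (hω : ω ≠ 0)
    (hL : 3 ≤ L) {Q : Op L} {F : Finset (Fin L) → Finset (Fin L) → Sym L} (hQ : IsSymbol Q F)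
    (hF : Constraints g ω μ (hopMat L t) (L / 2) F)
    (hD : ∀ n : ℤ, 0 < n → ∀ S S', comp n (F S S') = 0) {k : ℕ} (hk : 1 ≤ k) :
    Q ∈ supportSpan L k := by
  have hgC : (g : ℂ) ≠ 0 := by exact_mod_cast hg
  have hωC : (ω : ℂ) ≠ 0 := by exact_mod_cast hω
  have hC : ∀ S S', F S S' = C (coeff 0 (F S S')) := fun S S' =>
    eq_C_of_comp_eq_zero fun n hn => hD n hn S S'
  have h0 : ∀ S S', comp 0 (F S S') = F S S' := by
    intro S S'
    rw [hC, comp_C, if_pos rfl]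
  have hoff : ∀ S S', S ≠ S' → F S S' = 0 := by
    intro S S' hS
    rw [← h0, comp_top_offDiag hgC hF hD hS]
  -- Invariance under swaps also holds for D = 0. Independence of the particle number does not,
  -- because derivatives do not see constants; this leaves room for the fermion number operator.
  have hcard : ∀ S S', S.card = S'.card → coeff 0 (F S S) = coeff 0 (F S' S') := by
    intro S S' hS
    have := comp_top_card hgC hF hD hωC (by omega) (hopMat_ne_zero hL ht) hS
    rw [h0, h0] at this
    rw [this]
  have haff := affine_of_second_difference (a := fun S => coeff 0 (F S S)) (h := L / 2) (by omega)
    (by omega) hcard (fun S i => by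
      have := congrArg (coeff 0) (hF.flip_flip S i)
      simpa using this)
  have hQ' : Q = coeff 0 (F ∅ ∅) • 1 +
      (coeff 0 (F {0} {0}) - coeff 0 (F ∅ ∅)) • ∑ i : Fin L, num i := by
    refine entry_ext fun S S' => ?_
    rw [hQ, map_add, map_smul, map_smul, entry_one, map_sum]
    simp only [entry_num]
    by_cases hS : S = S'
    · subst hS
      simp only [if_true, Finset.sum_ite_mem, Finset.univ_inter, Finset.sum_const]
      rw [hC, quant_C, haff S, add_smul, mul_smul, Nat.cast_smul_eq_nsmul]
    · simp [hS, hoff S S' hS]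
  rw [hQ']
  exact add_mem (Submodule.smul_mem _ _ (one_mem_supportSpan k))
    (Submodule.smul_mem _ _ (sum_num_mem_supportSpan hk))

theorem mem_supportSpan_of_commute {t g ω μ : ℝ} (ht : t ≠ 0) (hg : g ≠ 0) (hω : ω ≠ 0)
    {k : ℕ} (hL : 3 ≤ L) (hk2 : 2 ≤ k) (hkL : 2 * k ≤ L) {Q : Op L} (hQ : Q ∈ supportSpan L k)
    (hcomm : Q * hamiltonian L t g ω μ - hamiltonian L t g ω μ * Q = 0) {m : ℕ} (hm : 2 ≤ m) :
    Q ∈ supportSpan L m := by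
  have hgC : (g : ℂ) ≠ 0 := by exact_mod_cast hg
  have hωC : (ω : ℂ) ≠ 0 := by exact_mod_cast hω
  have htop := fun {F : Finset (Fin L) → Finset (Fin L) → Sym L}
    (hF : Constraints g ω μ (hopMat L t) (L / 2) F) {D : ℤ}
    (hD : ∀ n, D < n → ∀ S S', comp n (F S S') = 0) (hD0 : D ≠ 0) =>
    exists_comp_top_eq hgC hF hD hωC (by omega) (hopMat_ne_zero hL ht) (by omega) (by omega) hD0
  obtain ⟨F, hF, hFc⟩ := exists_constraints hkL hQ hcomm
  -- The bound on the degrees descends one step at a time down to 2, as `htop` kills every top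
  -- degree above 2.
  have hdesc : ∀ N : ℕ, (∀ n : ℤ, (N : ℤ) + 2 < n → ∀ S S', comp n (F S S') = 0) →
      ∀ n : ℤ, 2 < n → ∀ S S', comp n (F S S') = 0 := by
    intro N
    induction N with
    | zero => exact fun h n hn => h n (by simpa using hn)
    | succ N ih =>
      intro h
      apply ih
      intro n hn S S'
      by_cases hn' : n = (N : ℤ) + 1 + 2
      · obtain ⟨s, hs⟩ := htop hFc (D := n) (fun n' h' => h n' (by push_cast; omega)) (by omega)
        rw [hs, if_neg (by omega)]
      · exact h n (by push_cast; omega) S S'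
  obtain ⟨N, hN⟩ := exists_comp_eq_zero F
  have h2 := hdesc N fun n hn => hN n (by omega)
  obtain ⟨s, hs⟩ := htop hFc (D := 2) h2 (by norm_num)
  set H := hamiltonian L t g ω μ with hH
  -- The degree-two part of H is ω times the phonon number, so this multiple of H cancels the
  -- degree-two part of Q.
  have hQ' : Q - (s / ω : ℂ) • H ∈ supportSpan L k :=
    sub_mem hQ (Submodule.smul_mem _ _ (hamiltonian_mem_supportSpan t g ω μ hk2))
  have hcomm' : (Q - (s / ω : ℂ) • H) * H - H * (Q - (s / ω : ℂ) • H) = 0 := by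
    rw [sub_mul, mul_sub, smul_mul_assoc, mul_smul_comm, sub_sub_sub_cancel_right]
    exact hcomm
  -- The difference is again conserved and of support k, so the whole analysis applies to it;
  -- injectivity of `quant` identifies its symbol.
  obtain ⟨G, hG, hGc⟩ := exists_constraints hkL hQ' hcomm'
  have hGF : ∀ S S', G S S' = F S S' - C (s / ω : ℂ) * hamSymbol t g ω μ S S' := by
    intro S S'
    apply quant_injective
    rw [← hG, map_sub, map_smul, hF, isSymbol_hamiltonian, map_sub, C_mul', map_smul]
  have hG1 : ∀ n : ℤ, 1 < n → ∀ S S', comp n (G S S') = 0 := by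
    intro n hn S S'
    rw [hGF, map_sub, weightedHomogeneousComponent_C_mul, comp_hamSymbol t g ω μ hn]
    by_cases hn2 : n = 2
    · subst hn2
      rw [hs]
      split_ifs
      · rw [← mul_assoc, ← C_mul, div_mul_cancel₀ _ hωC, sub_self]
      · rw [mul_zero, sub_zero]
    · rw [h2 n (by omega), if_neg (fun h => hn2 h.2), mul_zero, sub_zero]
  have hG0 : ∀ n : ℤ, 0 < n → ∀ S S', comp n (G S S') = 0 := by
    intro n hn S S'
    by_cases hn1 : n = 1
    · subst hn1
      obtain ⟨s', hs'⟩ := htop hGc (D := 1) hG1 (by norm_num)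
      rw [hs', if_neg (by norm_num)]
    · exact hG1 n (by omega) S S'
  have h3 := mem_supportSpan_of_comp_eq_zero ht hg hω hL hG hGc hG0 (k := m) (by omega)
  have h4 := add_mem h3 (Submodule.smul_mem _ (s / ω : ℂ)
    (hamiltonian_mem_supportSpan (L := L) t g ω μ hm))
  rwa [sub_add_cancel] at h4

end Main

end Holstein

theorem mainTheorem5 (L : ℕ) [NeZero L] (t g ω μ : ℝ) (ht : t ≠ 0) (hg : g ≠ 0) (hω : ω ≠ 0)
    (k : ℕ) (hk : 3 ≤ k) (hkL : (k : ℝ) ≤ (L : ℝ) / 2) :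
    ¬ ∃ Q : Holstein.Op L,
      Holstein.IsLocalConservedQuantity (Holstein.hamiltonian L t g ω μ) k Q := by
  rintro ⟨Q, ⟨hQ, hQ'⟩, hcomm⟩
  have hkL' : 2 * k ≤ L := by
    rw [le_div_iff₀ two_pos] at hkL
    exact_mod_cast (mul_comm (k : ℝ) 2) ▸ hkL
  -- The last side condition is 2 ≤ k − 1, the place where k ≥ 3 is essential.
  exact hQ' (Holstein.mem_supportSpan_of_commute ht hg hω (by omega) (by omega) hkL' hQ hcomm
    (by omega))
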